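/- Let $\bar R\to R\to S$ be surjective maps of coherent commutative rings, $I=\ker(\bar R\to S)$, $J=\ker(\bar R\to R)$. Assume that $IJ=0$ (so that $J$ is an $S$-module) and that $R$ is finitely presented over $\bar R$ and $S$ is finitely presented over $R$. For an $R$-linear abelian category $\mathcal C$, a finitely presented $R$-module $M$ and $X\in\mathcal C$, the object $\mathrm{Hom}_R(M,X)\in\mathcal C$ is the one that represents $Y\mapsto\mathrm{Hom}_R(M,\mathcal C(Y,X))$; $X$ is coflat if $\mathrm{Hom}_R(-,X)$ is exact on finitely presented modules. An $R$-linear abelian category with enough injectives is flat if its injectives are coflat. A flat abelian $R$-deformation of a flat $S$-linear abelian category $\mathcal C_0$ is an $R$-linear functor $\mathcal C_0\to\mathcal C$ to a flat $R$-linear abelian category that induces an equivalence of $\mathcal C_0$ with the category of objects $C$ of $\mathcal C$ with an $S$-structure $S\to\mathcal C(C,C)$ extending the $R$-structure. For an $S$-module $M$, finitely presented over $R$, this equivalence makes $\mathrm{Hom}_R(M,-)$ a functor $\mathcal C\to\mathcal C_0$. Let $\mathcal C_0\to\mathcal C\to\bar{\mathcal C}$ be flat abelian deformations along $\bar R\to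 R\to S$, all three categories having enough injectives. Consider the right derived functors $F=R\mathrm{Hom}_{\bar R}(R,-):D^+(\bar{\mathcal C})\to D^+(\mathcal C)$ and $R\mathrm{Hom}_R(J,-),R\mathrm{Hom}_R(S,-):D^+(\mathcal C)\to D^+(\mathcal C_0)$. For $C^\cdot\in D^+(\mathcal C)$ let $L_F(C^\cdot)$ be the groupoid of lifts of $C^\cdot$ along $F$: objects are pairs of $\bar C^\cdot\in D^+(\bar{\mathcal C})$ and an isomorphism $c:C^\cdot\cong F(\bar C^\cdot)$, and morphisms $(\bar C^\cdot,c)\to(\bar C'^\cdot,c')$ are isomorphisms $\bar f:\bar C^\cdot\to\bar C'^\cdot$ with $F(\bar f)c=c'$. Let $\mathrm{Sk}(L_F(C^\cdot))$ be its class of isomorphism classes, and put $$\mathbf C^\cdot=R\mathrm{Hom}_{\mathcal C_0}(R\mathrm{Hom}_R(J,C^\cdot),R\mathrm{Hom}_R(S,C^\cdot)),\qquad H^n\mathbf C=\mathrm{Hom}_{D(\mathcal C_0)}(R\mathrm{Hom}_R(J,C^\cdot),R\mathrm{Hom}_R(S,C^\cdot)[n]).$$ 1. There is an obstruction $o(C^\cdot)\in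 H^2\mathbf C$ such that $o(C^\cdot)=0\iff L_F(C^\cdot)\neq\varnothing$. 2. If $o(C^\cdot)=0$, then $\mathrm{Sk}(L_F(C^\cdot))$ is affine over (a torsor under) $H^1\mathbf C$. Here the obstruction and the affine structure are the following ones. Let $E^\cdot$ be any bounded below complex of injectives of $\mathcal C$ with an isomorphism $E^\cdot\cong C^\cdot$ in $D^+(\mathcal C)$, so that $H^n\mathbf C=H^n\mathrm{Hom}_{\mathcal C_0}(\mathrm{Hom}_R(J,E^\cdot),\mathrm{Hom}_R(S,E^\cdot))$. Morphisms $\bar E^p\to\bar E^q$ between injectives of $\bar{\mathcal C}$ with $\mathrm{Hom}_{\bar R}(R,\bar E^p)\cong E^p$ and $\mathrm{Hom}_{\bar R}(R,\bar E^q)\cong E^q$ that $\mathrm{Hom}_{\bar R}(R,-)$ sends to $0$ are identified with morphisms $\mathrm{Hom}_R(J,E^p)\to\mathrm{Hom}_R(S,E^q)$ in $\mathcal C_0$ through the canonical maps $\bar E^p\to\mathrm{Hom}_{\bar R}(J,\bar E^p)\cong\mathrm{Hom}_R(J,E^p)$ and $\mathrm{Hom}_R(S,E^q)\to E^q\to\bar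 E^q$. For every graded lift $\bar E^\cdot$ of $E^\cdot$ to injectives of $\bar{\mathcal C}$ and every degree one map $\bar d$ on it that lifts $d_E$, the square $\bar d^2$ is in this way a cocycle, and $o(C^\cdot)$ is its class. For two lifts of the complex $E^\cdot$ to bounded below complexes $\bar E^\cdot,\bar E'^\cdot$ of injectives of $\bar{\mathcal C}$, the difference $[\bar E'^\cdot]-[\bar E^\cdot]\in H^1\mathbf C$ of the corresponding elements of $\mathrm{Sk}(L_F(C^\cdot))$ is the class of $d_{\bar E'}\varphi-\varphi d_{\bar E}$, for some graded map $\varphi:\bar E^\cdot\to\bar E'^\cdot$ that lifts the identity of $E^\cdot$. -/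

import Mathlib

open CategoryTheory CategoryTheory.Limits CochainComplex.HomComplex

namespace DerivedLifting

/-- A commutative ring is coherent if every finitely generated ideal is finitely presented. -/
class IsCoherentRing (A : Type*) [CommRing A] : Prop where
  finitePresentation_of_fg : ∀ I : Ideal A, I.FG → Module.FinitePresentation A I

/-- The maps `Rb → R → S` are surjective and `I * J = 0`, where `I = Ker (Rb → S)` and
`J = Ker (Rb → R)`. -/
class SmallExtension (Rb R S : Type*) [CommRing Rb] [CommRing R] [CommRing S]
    [Algebra Rb R] [Algebra R S] : Prop where
  surjective_left : Function.Surjective (algebraMap Rb R)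
  surjective_right : Function.Surjective (algebraMap R S)
  mul_eq_bot : RingHom.ker ((algebraMap R S).comp (algebraMap Rb R)) *
    RingHom.ker (algebraMap Rb R) = ⊥

section Kernel

variable (Rb R S : Type*) [CommRing Rb] [CommRing R] [CommRing S] [Algebra Rb R] [Algebra R S]

/-- The ideal `J = Ker (Rb → R)`, considered as a module over `R` and over `S`
(see the instances below). -/
def RelKernel (Rb R S : Type*) [CommRing Rb] [CommRing R] [CommRing S]
    [Algebra Rb R] [Algebra R S] : Type _ :=
  RingHom.ker (algebraMap Rb R)

instance : AddCommGroup (RelKernel Rb R S) :=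
  inferInstanceAs (AddCommGroup (RingHom.ker (algebraMap Rb R)))

/-- The inclusion of the ideal `J` in `Rb`. -/
def RelKernel.incl : RelKernel Rb R S →+ Rb :=
  (Submodule.subtype (RingHom.ker (algebraMap Rb R))).toAddMonoidHom

variable [SmallExtension Rb R S]

lemma SmallExtension.surjective_comp :
    Function.Surjective ((algebraMap R S).comp (algebraMap Rb R)) := by
  rw [RingHom.coe_comp]
  exact (surjective_right Rb).comp (surjective_left S)

/-- The action of `S` on `J`: lift the scalar to `Rb` and multiply. -/
noncomputable instance : SMul S (RelKernel Rb R S) where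
  smul s j := (Function.surjInv (SmallExtension.surjective_comp Rb R S) s •
    (show RingHom.ker (algebraMap Rb R) from j) : RingHom.ker (algebraMap Rb R))

lemma RelKernel.smul_eq (x : Rb) (j : RingHom.ker (algebraMap Rb R)) :
    (((algebraMap R S).comp (algebraMap Rb R)) x • (show RelKernel Rb R S from j) :
      RelKernel Rb R S) = (x • j : RingHom.ker (algebraMap Rb R)) := by
  set f := (algebraMap R S).comp (algebraMap Rb R) with hf
  have h : f (Function.surjInv (SmallExtension.surjective_comp Rb R S) (f x)) = f x :=
    Function.surjInv_eq _ _
  refine Subtype.ext ?_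
  change Function.surjInv (SmallExtension.surjective_comp Rb R S) (f x) * j.1 = x * j.1
  rw [← sub_eq_zero, ← sub_mul, ← Ideal.mem_bot, ← SmallExtension.mul_eq_bot (Rb := Rb) (R := R) (S := S)]
  refine Ideal.mul_mem_mul ?_ j.2
  exact (RingHom.sub_mem_ker_iff _).mpr h

/-- As `I * J = 0`, the ideal `J` is a module over `S = Rb / I`. -/
noncomputable instance : Module S (RelKernel Rb R S) :=
  letI : Module Rb (RelKernel Rb R S) :=
    inferInstanceAs (Module Rb (RingHom.ker (algebraMap Rb R)))
  Function.Surjective.moduleLeft ((algebraMap R S).comp (algebraMap Rb R))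
    (SmallExtension.surjective_comp Rb R S) (RelKernel.smul_eq Rb R S)

/-- The `R`-module structure of `J`, by restriction of scalars along `R → S`. -/
noncomputable instance : Module R (RelKernel Rb R S) :=
  Module.compHom _ (algebraMap R S)

instance : IsScalarTower R S (RelKernel Rb R S) where
  smul_assoc r s j := by
    rw [Algebra.smul_def, mul_smul]; rfl

theorem RelKernel.finitePresentation [IsCoherentRing Rb] [Module.FinitePresentation Rb R] :
    Module.FinitePresentation R (RelKernel Rb R S) := by
  have hs := SmallExtension.surjective_left (Rb := Rb) (R := R) S
  have hfg : (RingHom.ker (algebraMap Rb R)).FG :=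
    Module.FinitePresentation.fg_ker (Algebra.linearMap Rb R) hs
  have hfp := IsCoherentRing.finitePresentation_of_fg _ hfg
  let _ : Module Rb (RelKernel Rb R S) :=
    inferInstanceAs (Module Rb (RingHom.ker (algebraMap Rb R)))
  have : Module.FinitePresentation Rb (RelKernel Rb R S) := hfp
  have : IsScalarTower Rb R (RelKernel Rb R S) := by
    refine IsScalarTower.of_algebraMap_smul fun x j ↦ ?_
    exact RelKernel.smul_eq Rb R S x j
  refine FinitePresentation.of_isBaseChange (R := Rb)
    (LinearMap.id : RelKernel Rb R S →ₗ[Rb] RelKernel Rb R S) ?_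
  refine IsBaseChange.of_lift_unique _ fun Q _ _ _ _ g ↦ ?_
  refine ⟨{ g with map_smul' := fun r j ↦ ?_ }, ?_, ?_⟩
  · obtain ⟨x, rfl⟩ := hs r
    simp
  · ext; rfl
  · intro g' hg'
    ext j
    exact LinearMap.congr_fun hg' j

instance [IsCoherentRing Rb] [Module.FinitePresentation Rb R] :
    Module.FinitePresentation R (RelKernel Rb R S) :=
  RelKernel.finitePresentation Rb R S

end Kernel

section HomObj

variable (R : Type*) [CommRing R] {C : Type*} [Category C] [Abelian C] [Linear R C]

/-- An object `Hom_R(M, X)` of an `R`-linear category `C`, for an `R`-module `M` and `X : C`: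
it represents the functor that sends `Y` to the set of `R`-linear maps `M → C(Y, X)`;
`ev` is the universal such map. -/
structure HomObj (M : Type*) [AddCommGroup M] [Module R M] (X : C) where
  obj : C
  ev : M →ₗ[R] (obj ⟶ X)
  existsUnique_lift : ∀ (Y : C) (φ : M →ₗ[R] (Y ⟶ X)), ∃! g : Y ⟶ obj, ∀ m, g ≫ ev m = φ m

/-- If `M` is finitely presented and `C` is abelian, then `Hom_R(M, X)` exists. -/
theorem HomObj.nonempty (M : Type*) [AddCommGroup M] [Module R M] [Module.FinitePresentation R M]
    (X : C) : Nonempty (HomObj R M X) := by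
  have := Abelian.hasFiniteBiproducts (C := C)
  obtain ⟨n, m, f, g, hf, hfg⟩ := Module.FinitePresentation.exists_fin' R M
  let δ : (⨁ fun _ : Fin n => X) ⟶ (⨁ fun _ : Fin m => X) :=
    biproduct.lift fun b => ∑ a, g (Pi.single b 1) a • biproduct.π (fun _ : Fin n => X) a
  let Φ : (Fin n → R) →ₗ[R] (kernel δ ⟶ X) :=
    Fintype.linearCombination R fun a => kernel.ι δ ≫ biproduct.π (fun _ : Fin n => X) a
  have hδ : ∀ b, ∑ a, g (Pi.single b 1) a • (kernel.ι δ ≫ biproduct.π (fun _ : Fin n => X) a) = 0 := by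
    intro b
    have := congrArg (· ≫ biproduct.π (fun _ : Fin m => X) b) (kernel.condition δ)
    rw [zero_comp, Category.assoc, biproduct.lift_π, Preadditive.comp_sum] at this
    simpa only [Linear.comp_smul] using this
  have hΦ : LinearMap.ker f ≤ LinearMap.ker Φ := by
    rw [LinearMap.exact_iff.mp hfg, LinearMap.range_le_ker_iff]
    ext b
    simp [Φ, Fintype.linearCombination_apply, hδ]
  let ev : M →ₗ[R] (kernel δ ⟶ X) :=
    (LinearMap.ker f).liftQ Φ hΦ ∘ₗ (f.quotKerEquivOfSurjective hf).symm.toLinearMap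
  have hev : ∀ r, ev (f r) = Φ r := by
    intro r
    have : (f.quotKerEquivOfSurjective hf).symm (f r) = Submodule.Quotient.mk r := by
      rw [LinearEquiv.symm_apply_eq]; rfl
    simp [ev, this]
  have hev1 : ∀ a, ev (f (Pi.single a 1)) = kernel.ι δ ≫ biproduct.π (fun _ : Fin n => X) a := by
    intro a
    simp [hev, Φ]
  refine ⟨⟨kernel δ, ev, fun Y φ => ?_⟩⟩
  have key : ∀ r : Fin n → R, φ (f r) = ∑ a, r a • φ (f (Pi.single a 1)) := by
    intro r
    have h := (φ ∘ₗ f).pi_apply_eq_sum_univ r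
    rw [LinearMap.comp_apply] at h
    rw [h]
    refine Finset.sum_congr rfl fun a _ => ?_
    have ha : (fun j => if a = j then (1 : R) else 0) = Pi.single a 1 := by
      funext b
      simp [Pi.single_apply, eq_comm]
    rw [ha, LinearMap.comp_apply]
  refine ⟨kernel.lift δ (biproduct.lift fun a => φ (f (Pi.single a 1))) ?_, ?_, ?_⟩
  · ext b
    simp [δ, Preadditive.comp_sum, ← key, hfg.apply_apply_eq_zero]
  · intro x
    obtain ⟨r, rfl⟩ := hf x
    simp [hev, Φ, key r, Fintype.linearCombination_apply, Preadditive.comp_sum]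
  · intro h hh
    rw [← cancel_mono (kernel.ι δ)]
    ext a
    simp [← hh, hev1]

namespace HomObj

variable {R} {M : Type*} [AddCommGroup M] [Module R M] {X : C} (H : HomObj R M X)

/-- The morphism `Y ⟶ Hom_R(M, X)` that corresponds to an `R`-linear map `M → C(Y, X)`. -/
noncomputable def lift {Y : C} (φ : M →ₗ[R] (Y ⟶ X)) : Y ⟶ H.obj :=
  (H.existsUnique_lift Y φ).choose

@[simp]
lemma lift_ev {Y : C} (φ : M →ₗ[R] (Y ⟶ X)) (m : M) : H.lift φ ≫ H.ev m = φ m :=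
  (H.existsUnique_lift Y φ).choose_spec.1 m

lemma hom_ext {Y : C} {g g' : Y ⟶ H.obj} (h : ∀ m, g ≫ H.ev m = g' ≫ H.ev m) : g = g' :=
  (H.existsUnique_lift Y ((Linear.leftComp R X g') ∘ₗ H.ev)).unique h fun _ => rfl

end HomObj

variable (M : Type*) [AddCommGroup M] [Module R M] [Module.FinitePresentation R M]

/-- The object `Hom_R(M, X)`, for a finitely presented module `M`. -/
noncomputable def homObj (X : C) : HomObj R M X := (HomObj.nonempty R M X).some

/-- Functoriality of `Hom_R(M, X)` in `X`. -/
noncomputable def homMapRight {X X' : C} (f : X ⟶ X') :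
    (homObj R M X).obj ⟶ (homObj R M X').obj :=
  (homObj R M X').lift (Linear.rightComp R _ f ∘ₗ (homObj R M X).ev)

@[simp]
lemma homMapRight_ev {X X' : C} (f : X ⟶ X') (m : M) :
    homMapRight R M f ≫ (homObj R M X').ev m = (homObj R M X).ev m ≫ f := by
  simp [homMapRight]

@[simp]
lemma homMapRight_ev_assoc {X X' Y : C} (f : X ⟶ X') (m : M) (h : X' ⟶ Y) :
    homMapRight R M f ≫ (homObj R M X').ev m ≫ h = (homObj R M X).ev m ≫ f ≫ h := by
  rw [← Category.assoc, homMapRight_ev, Category.assoc]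

variable {M} {N P : Type*} [AddCommGroup N] [Module R N] [Module.FinitePresentation R N]
  [AddCommGroup P] [Module R P] [Module.FinitePresentation R P]

/-- Contravariant functoriality of `Hom_R(M, X)` in `M`. -/
noncomputable def homMapLeft (f : M →ₗ[R] N) (X : C) :
    (homObj R N X).obj ⟶ (homObj R M X).obj :=
  (homObj R M X).lift ((homObj R N X).ev ∘ₗ f)

@[simp]
lemma homMapLeft_ev (f : M →ₗ[R] N) (X : C) (m : M) :
    homMapLeft R f X ≫ (homObj R M X).ev m = (homObj R N X).ev (f m) := by
  simp [homMapLeft]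

@[simp]
lemma homMapLeft_ev_assoc (f : M →ₗ[R] N) {X Y : C} (m : M) (h : X ⟶ Y) :
    homMapLeft R f X ≫ (homObj R M X).ev m ≫ h = (homObj R N X).ev (f m) ≫ h := by
  rw [← Category.assoc, homMapLeft_ev]

lemma homMapLeft_comp_eq_zero {f : M →ₗ[R] N} {g : N →ₗ[R] P} (h : Function.Exact f g) (X : C) :
    homMapLeft R g X ≫ homMapLeft R f X = 0 := by
  refine HomObj.hom_ext _ fun m => ?_
  simp [h.apply_apply_eq_zero]

end HomObj

section Flat

universe u

/-- `X` is coflat if `Hom_R(-, X)`, from finitely presented `R`-modules to `C`, is exact.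
(Every finitely presented module is isomorphic to one in the universe of `R`.) -/
def IsCoflat (R : Type u) [CommRing R] {C : Type*} [Category C] [Abelian C] [Linear R C]
    (X : C) : Prop :=
  ∀ (M N P : Type u) [AddCommGroup M] [AddCommGroup N] [AddCommGroup P]
    [Module R M] [Module R N] [Module R P] [Module.FinitePresentation R M]
    [Module.FinitePresentation R N] [Module.FinitePresentation R P]
    (f : M →ₗ[R] N) (g : N →ₗ[R] P) (_ : Function.Injective f) (_ : Function.Surjective g)
    (hfg : Function.Exact f g),
    (ShortComplex.mk _ _ (homMapLeft_comp_eq_zero R hfg X)).ShortExact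

/-- An `R`-linear abelian category with enough injectives is flat if its injectives are coflat. -/
class IsFlatAbelian (R : Type u) [CommRing R] (C : Type*) [Category C] [Abelian C]
    [Linear R C] : Prop where
  isCoflat_of_injective : ∀ (E : C), Injective E → IsCoflat R E

end Flat

section ScalarObj

variable (R S : Type*) [CommRing R] [CommRing S] [Algebra R S]

/-- The category `C_S` of `S`-objects of an `R`-linear category `C`: an object is an object
of `C` with a map `S → C(X, X)` that extends the `R`-structure. -/
structure ScalarObj (C : Type*) [Category C] [Preadditive C] [Linear R C] where
  obj : C
  act : S →ₐ[R] End obj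

variable {R S} {C C₀ : Type*} [Category C] [Category C₀]

namespace ScalarObj

variable [Preadditive C] [Linear R C]

/-- Morphisms of `S`-objects commute with the action of `S`. -/
@[ext]
structure Hom (X Y : ScalarObj R S C) where
  hom : X.obj ⟶ Y.obj
  comm : ∀ s : S, X.act s ≫ hom = hom ≫ Y.act s

instance : Category (ScalarObj R S C) where
  Hom := Hom
  id X := ⟨𝟙 _, by simp⟩
  comp f g := ⟨f.hom ≫ g.hom, fun s => by
    rw [← Category.assoc, f.comm, Category.assoc, g.comm, Category.assoc]⟩
  id_comp f := Hom.ext (Category.id_comp f.hom)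
  comp_id f := Hom.ext (Category.comp_id f.hom)
  assoc f g h := Hom.ext (Category.assoc f.hom g.hom h.hom)

@[simp] lemma id_hom (X : ScalarObj R S C) : Hom.hom (𝟙 X) = 𝟙 X.obj := rfl

@[simp] lemma comp_hom {X Y Z : ScalarObj R S C} (f : X ⟶ Y) (g : Y ⟶ Z) :
    Hom.hom (f ≫ g) = Hom.hom f ≫ Hom.hom g := rfl

end ScalarObj

variable [Preadditive C] [Linear R C] [Preadditive C₀] [Linear S C₀]

/-- A functor from an `S`-linear category to an `R`-linear category is `R`-linear, where the
source is an `R`-linear category through `R → S`. -/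
class IsLinearAlong (R S : Type*) [CommRing R] [CommRing S] [Algebra R S]
    {C C₀ : Type*} [Category C] [Category C₀] [Preadditive C] [Linear R C]
    [Preadditive C₀] [Linear S C₀] (i : C₀ ⥤ C) : Prop extends i.Additive where
  map_algebraMap_smul : ∀ {X Y : C₀} (r : R) (f : X ⟶ Y),
    i.map (algebraMap R S r • f) = r • i.map f

variable (R S) in
/-- The functor `C₀ ⥤ C_S` induced by an `R`-linear functor `C₀ ⥤ C`, for `C₀` an `S`-linear category. -/
def toScalarObj (i : C₀ ⥤ C) [IsLinearAlong R S i] : C₀ ⥤ ScalarObj R S C where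
  obj X :=
    { obj := i.obj X
      act :=
        { toFun := fun s => i.map (s • 𝟙 X)
          map_one' := by simp [End.one_def]
          map_mul' := fun s t => by simp [End.mul_def, ← i.map_comp, smul_smul]
          map_zero' := by simp
          map_add' := fun s t => by simp [add_smul, i.map_add]
          commutes' := fun r => by
            rw [IsLinearAlong.map_algebraMap_smul, i.map_id, Algebra.algebraMap_eq_smul_one]
            rfl } }
  map f := ⟨i.map f, fun s => by
    change i.map _ ≫ i.map f = i.map f ≫ i.map _
    simp [← i.map_comp]⟩
  map_id X := ScalarObj.Hom.ext (i.map_id X)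
  map_comp f g := ScalarObj.Hom.ext (i.map_comp f g)

/-- `i : C₀ ⥤ C` is an `R`-deformation of the `S`-linear category `C₀`: it is `R`-linear and induces
an equivalence of `C₀` with the category `C_S` of `S`-objects of `C`. -/
class IsAbelianDeformation (R S : Type*) [CommRing R] [CommRing S] [Algebra R S]
    {C C₀ : Type*} [Category C] [Category C₀] [Preadditive C] [Linear R C]
    [Preadditive C₀] [Linear S C₀] (i : C₀ ⥤ C) : Prop extends IsLinearAlong R S i where
  isEquivalence : (toScalarObj R S i).IsEquivalence

end ScalarObj

section Coinduction

variable (R S : Type*) [CommRing R] [CommRing S] [Algebra R S]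
  {C C₀ : Type*} [Category C] [Abelian C] [Linear R C]
  (M : Type*) [AddCommGroup M] [Module R M] [Module S M] [IsScalarTower R S M]
  [Module.FinitePresentation R M]

/-- For an `S`-module `M`, `X ↦ Hom_R(M, X)` as a functor from `C` to the `S`-objects of `C`. -/
noncomputable def homScalar : C ⥤ ScalarObj R S C where
  obj X :=
    { obj := (homObj R M X).obj
      act :=
        { toFun := fun s => homMapLeft R (Module.toModuleEnd R (S := S) M s) X
          map_one' := HomObj.hom_ext _ fun m => by simp [End.one_def]
          map_mul' := fun s t => HomObj.hom_ext _ fun m => by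
            simp [End.mul_def, mul_smul, smul_comm s t m]
          map_zero' := HomObj.hom_ext _ fun m => by simp
          map_add' := fun s t => HomObj.hom_ext _ fun m => by
            rw [Preadditive.add_comp]; simp [add_smul]
          commutes' := fun r => HomObj.hom_ext _ fun m => by
            rw [Algebra.algebraMap_eq_smul_one (A := End (homObj R M X).obj)]
            change _ = (r • 𝟙 (homObj R M X).obj) ≫ _
            simp } }
  map f := ⟨homMapRight R M f, fun s => HomObj.hom_ext _ fun m => by
    change (homMapLeft R _ _ ≫ _) ≫ _ = (_ ≫ homMapLeft R _ _) ≫ _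
    simp⟩
  map_id X := ScalarObj.Hom.ext <| HomObj.hom_ext _ fun m => by simp
  map_comp f g := ScalarObj.Hom.ext <| HomObj.hom_ext _ fun m => by simp

variable [Category C₀] [Preadditive C₀] [Linear S C₀] (i : C₀ ⥤ C) [IsAbelianDeformation R S i]

/-- The equivalence of `C₀` with `C_S` that is part of a deformation. -/
noncomputable def deformationEquiv : C₀ ≌ ScalarObj R S C :=
  haveI := IsAbelianDeformation.isEquivalence (R := R) (S := S) (i := i)
  (toScalarObj R S i).asEquivalence

/-- For an `S`-module `M` that is finitely presented over `R` and a deformation `i : C₀ ⥤ C`,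
the functor `Hom_R(M, -) : C ⥤ C₀` (under the identification of `C₀` with `C_S`).
For `M = S` it is the right adjoint `Hom_R(S, -)` of `i`. -/
noncomputable def homFunctor : C ⥤ C₀ :=
  homScalar R S M ⋙ (deformationEquiv R S i).inverse

/-- Evaluation at `m : M`, a morphism from (the image in `C` of) `Hom_R(M, X)` to `X`. -/
noncomputable def homFunctorEv (X : C) (m : M) : i.obj ((homFunctor R S M i).obj X) ⟶ X :=
  ScalarObj.Hom.hom ((deformationEquiv R S i).counit.app ((homScalar R S M).obj X)) ≫
    (homObj R M X).ev m

instance : (homFunctor R S M i).Additive where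
  map_add {X Y f g} := by
    refine (deformationEquiv R S i).functor.map_injective (ScalarObj.Hom.ext ?_)
    have key : ∀ h : X ⟶ Y, ScalarObj.Hom.hom
        ((deformationEquiv R S i).functor.map ((homFunctor R S M i).map h)) =
        ScalarObj.Hom.hom ((deformationEquiv R S i).counit.app ((homScalar R S M).obj X)) ≫
          homMapRight R M h ≫ ScalarObj.Hom.hom
            ((deformationEquiv R S i).counitInv.app ((homScalar R S M).obj Y)) := by
      intro h
      simp only [homFunctor, Functor.comp_map, Equivalence.fun_inv_map]
      rfl
    have hadd : homMapRight R M (f + g) = homMapRight R M f + homMapRight R M g :=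
      HomObj.hom_ext _ fun m => by simp
    have hmap : ScalarObj.Hom.hom ((deformationEquiv R S i).functor.map
        ((homFunctor R S M i).map f + (homFunctor R S M i).map g)) =
        ScalarObj.Hom.hom ((deformationEquiv R S i).functor.map ((homFunctor R S M i).map f)) +
        ScalarObj.Hom.hom ((deformationEquiv R S i).functor.map ((homFunctor R S M i).map g)) :=
      i.map_add
    rw [hmap, key, key, key, hadd]
    exact (congrArg (_ ≫ ·) (Preadditive.add_comp ..)).trans (Preadditive.comp_add ..)

end Coinduction

section Lift

variable {A B : Type*} [Category A] [Category B]

/-- A lift of `X` along `F`: an object with an isomorphism from `X` to its image. -/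
structure Lift (F : A ⥤ B) (X : B) where
  obj : A
  iso : X ≅ F.obj obj

namespace Lift

variable {F : A ⥤ B} {X : B}

/-- A morphism of lifts of `X` is an isomorphism of the underlying objects whose image under `F`
is compatible with the isomorphisms from `X`. -/
@[ext]
structure Hom (ℓ ℓ' : Lift F X) where
  iso : ℓ.obj ≅ ℓ'.obj
  w : ℓ.iso.hom ≫ F.map iso.hom = ℓ'.iso.hom

/-- The groupoid `L_F(X)` of lifts of `X` along `F`. -/
instance : Groupoid (Lift F X) where
  Hom := Hom
  id ℓ := ⟨Iso.refl _, by simp⟩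
  comp f g := ⟨f.iso ≪≫ g.iso, by rw [Iso.trans_hom, F.map_comp, ← Category.assoc, f.w, g.w]⟩
  id_comp f := Hom.ext (Iso.refl_trans f.iso)
  comp_id f := Hom.ext (Iso.trans_refl f.iso)
  assoc f g h := Hom.ext (Iso.trans_assoc f.iso g.iso h.iso)
  inv f := ⟨f.iso.symm, by rw [← f.w, Category.assoc, ← F.map_comp]; simp⟩
  inv_comp f := Hom.ext f.iso.symm_self_id
  comp_inv f := Hom.ext f.iso.self_symm_id

end Lift

/-- The skeleton: the isomorphism classes of objects. -/
abbrev Sk (D : Type*) [Category D] : Type _ := Quotient (isIsomorphicSetoid D)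

end Lift

section Derived

variable {C D : Type*} [Category C] [Category D] [Abelian C] [Abelian D]
  [HasDerivedCategory C] [HasDerivedCategory D]

/-- `Hⁿ RHom(X, Y)` for `X` and `Y` in the bounded below derived category of `C`, i.e. the group of
morphisms `X ⟶ Y⟦n⟧` in the derived category of `C`. -/
abbrev RHomCohomology (X Y : DerivedCategory.Plus C) (n : ℤ) : Type _ :=
  ShiftedHom X.obj Y.obj n

/-- The canonical map `G K ⟶ RG K`, for a bounded below complex `K`. -/
noncomputable def derivedUnit (G : C ⥤ D) [G.Additive] [EnoughInjectives C]
    (K : CochainComplex.Plus C) :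
    DerivedCategory.Plus.Q.obj (G.mapCochainComplexPlus.obj K) ⟶
      G.rightDerivedFunctorPlus.obj (DerivedCategory.Plus.Q.obj K) :=
  G.rightDerivedFunctorPlusUnit.app ((HomotopyCategory.Plus.quotient C).obj K)

/-- A bounded below complex of injectives with an isomorphism to `X` in the derived category. -/
structure BddInjectiveResolution (X : DerivedCategory.Plus C) where
  complex : CochainComplex.Plus C
  injective : ∀ n, Injective (complex.obj.X n)
  iso : DerivedCategory.Plus.Q.obj complex ≅ X

/-- The canonical map (an isomorphism) `G E ⟶ RG X`, for an injective resolution `E` of `X`. -/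
noncomputable def BddInjectiveResolution.comparison {X : DerivedCategory.Plus C}
    (E : BddInjectiveResolution X) (G : C ⥤ D) [G.Additive] [EnoughInjectives C] :
    DerivedCategory.Q.obj (G.mapCochainComplexPlus.obj E.complex).obj ⟶
      (G.rightDerivedFunctorPlus.obj X).obj :=
  (DerivedCategory.quotientCompQhIso D).inv.app _ ≫
    (derivedUnit G E.complex ≫ G.rightDerivedFunctorPlus.map E.iso.hom).hom

/-- For an injective resolution `E` of `X`: `o` in `Hⁿ RHom(RG X, RG' X)` is the cohomology class of
the degree `n` cocycle `z` of the complex of homomorphisms `Hom(G E, G' E)`. -/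
def BddInjectiveResolution.IsClassOf {X : DerivedCategory.Plus C} (E : BddInjectiveResolution X)
    [EnoughInjectives C] {G G' : C ⥤ D} [G.Additive] [G'.Additive] {n : ℤ}
    (z : Cocycle (G.mapCochainComplexPlus.obj E.complex).obj
      (G'.mapCochainComplexPlus.obj E.complex).obj n)
    (o : RHomCohomology (G.rightDerivedFunctorPlus.obj X) (G'.rightDerivedFunctorPlus.obj X) n) :
    Prop :=
  E.comparison G ≫ o =
    ShiftedHom.map (Cocycle.equivHomShift.symm z) DerivedCategory.Q ≫ (E.comparison G')⟦n⟧'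

end Derived

/-- The right derived functor `RHom_R(M, -) : D⁺(C) ⥤ D⁺(C₀)` of `Hom_R(M, -) : C ⥤ C₀`. -/
noncomputable abbrev rHom (R S : Type*) [CommRing R] [CommRing S] [Algebra R S]
    {C C₀ : Type*} [Category C] [Category C₀] [Abelian C] [Abelian C₀] [Linear R C] [Linear S C₀]
    [EnoughInjectives C] [HasDerivedCategory C] [HasDerivedCategory C₀]
    (M : Type*) [AddCommGroup M] [Module R M] [Module S M] [IsScalarTower R S M]
    [Module.FinitePresentation R M] (i : C₀ ⥤ C) [IsAbelianDeformation R S i] :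
    DerivedCategory.Plus C ⥤ DerivedCategory.Plus C₀ :=
  (homFunctor R S M i).rightDerivedFunctorPlus

section Deformation

variable {Rb R S : Type*} [CommRing Rb] [CommRing R] [CommRing S] [Algebra Rb R] [Algebra R S]
  [IsCoherentRing Rb] [Module.FinitePresentation Rb R] [Module.FinitePresentation R S]
  [SmallExtension Rb R S]
  {Cb C C₀ : Type*} [Category Cb] [Category C] [Category C₀] [Abelian Cb] [Abelian C] [Abelian C₀]
  [Linear Rb Cb] [Linear R C] [Linear S C₀]
  (i : C ⥤ Cb) [IsAbelianDeformation Rb R i] (i₀ : C₀ ⥤ C) [IsAbelianDeformation R S i₀]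

variable (Rb R S) in
/-- Let `c : E ≅ Hom_Rb(R, Eb)` and `c' : E' ≅ Hom_Rb(R, Eb')`.
A morphism `θ : Eb ⟶ Eb'` corresponds to `g : Hom_R(J, E) ⟶ Hom_R(S, E')` in `C₀` if `θ` is the
composite of `g` with the canonical maps `p : Eb ⟶ Hom_Rb(J, Eb) = Hom_R(J, E)` (given by
multiplication by the elements of `J`) and `Hom_R(S, E') ⟶ E' ≅ Hom_Rb(R, Eb') ⟶ Eb'`.
For coflat `Eb` this identifies `Hom(Hom_R(J, E), Hom_R(S, E'))` with the group of morphisms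
`Eb ⟶ Eb'` that `Hom_Rb(R, -)` sends to zero. -/
def RepresentsKernelMap {E E' : C} {Eb Eb' : Cb}
    (c : E ≅ (homFunctor Rb R R i).obj Eb) (c' : E' ≅ (homFunctor Rb R R i).obj Eb')
    (g : (homFunctor R S (RelKernel Rb R S) i₀).obj E ⟶ (homFunctor R S S i₀).obj E')
    (θ : Eb ⟶ Eb') : Prop :=
  ∃ p : Eb ⟶ i.obj (i₀.obj ((homFunctor R S (RelKernel Rb R S) i₀).obj E)),
    (∀ j : RelKernel Rb R S,
      p ≫ i.map (homFunctorEv R S (RelKernel Rb R S) i₀ E j) ≫ i.map c.hom ≫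
        homFunctorEv Rb R R i Eb 1 = RelKernel.incl Rb R S j • 𝟙 Eb) ∧
    θ = p ≫ i.map (i₀.map g) ≫ i.map (homFunctorEv R S S i₀ E' 1) ≫ i.map c'.hom ≫
        homFunctorEv Rb R R i Eb' 1

/-- A lift of the graded object underlying `E` to a graded object of injectives, with a lift `d` of the
differential of `E` (it need not have square zero). -/
structure GradedLift (Rb R : Type*) [CommRing Rb] [CommRing R] [Algebra Rb R]
    [Module.FinitePresentation Rb R] {Cb C : Type*} [Category Cb] [Category C] [Abelian Cb]
    [Abelian C] [Linear Rb Cb] [Linear R C] (i : C ⥤ Cb) [IsAbelianDeformation Rb R i]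
    (E : CochainComplex.Plus C) where
  obj : ℤ → Cb
  injective : ∀ n, Injective (obj n)
  iso : ∀ n, E.obj.X n ≅ (homFunctor Rb R R i).obj (obj n)
  d : ∀ n, obj n ⟶ obj (n + 1)
  w : ∀ n, (iso n).hom ≫ (homFunctor Rb R R i).map (d n) =
    E.obj.d n (n + 1) ≫ (iso (n + 1)).hom

/-- A lift of a complex `E` along `Hom_Rb(R, -)` to a bounded below complex of injectives. -/
structure ComplexLift (Rb R : Type*) [CommRing Rb] [CommRing R] [Algebra Rb R]
    [Module.FinitePresentation Rb R] {Cb C : Type*} [Category Cb] [Category C] [Abelian Cb]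
    [Abelian C] [Linear Rb Cb] [Linear R C] (i : C ⥤ Cb) [IsAbelianDeformation Rb R i]
    (E : CochainComplex.Plus C) where
  complex : CochainComplex.Plus Cb
  injective : ∀ n, Injective (complex.obj.X n)
  iso : E ≅ (homFunctor Rb R R i).mapCochainComplexPlus.obj complex

section

variable {i} {E : CochainComplex.Plus C}

/-- The isomorphism `E.X n ≅ Hom_Rb(R, K.X n)`. -/
noncomputable def ComplexLift.isoX (K : ComplexLift Rb R i E) (n : ℤ) :
    E.obj.X n ≅ (homFunctor Rb R R i).obj (K.complex.obj.X n) :=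
  (HomologicalComplex.eval C (ComplexShape.up ℤ) n).mapIso
    ((CochainComplex.Plus.ι C).mapIso K.iso)

variable (S) in
/-- `z` is the degree 2 cocycle of `Hom(Hom_R(J, E), Hom_R(S, E))` that corresponds to the square of
the lifted pre-differential. -/
def GradedLift.IsSquare (L : GradedLift Rb R i E)
    (z : Cocycle ((homFunctor R S (RelKernel Rb R S) i₀).mapCochainComplexPlus.obj E).obj
      ((homFunctor R S S i₀).mapCochainComplexPlus.obj E).obj 2) : Prop :=
  ∀ n : ℤ, RepresentsKernelMap Rb R S i i₀ (L.iso n) (L.iso (n + 1 + 1))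
    (z.1.v n (n + 1 + 1) (by lia)) (L.d n ≫ L.d (n + 1))

variable (S) in
/-- `z` is the degree 1 cocycle of `Hom(Hom_R(J, E), Hom_R(S, E))` that corresponds to the difference
of the differentials of the lifts `K'` and `K` of `E`, where the underlying graded objects are
compared by a lift `φ` of the identity of `E`. -/
def ComplexLift.IsDifference (K K' : ComplexLift Rb R i E)
    (z : Cocycle ((homFunctor R S (RelKernel Rb R S) i₀).mapCochainComplexPlus.obj E).obj
      ((homFunctor R S S i₀).mapCochainComplexPlus.obj E).obj 1) : Prop :=
  ∃ φ : ∀ n, K.complex.obj.X n ⟶ K'.complex.obj.X n,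
    (∀ n, (K.isoX n).hom ≫ (homFunctor Rb R R i).map (φ n) = (K'.isoX n).hom) ∧
    ∀ n : ℤ, RepresentsKernelMap Rb R S i i₀ (K.isoX n) (K'.isoX (n + 1))
      (z.1.v n (n + 1) rfl)
      (φ n ≫ K'.complex.obj.d n (n + 1) - K.complex.obj.d n (n + 1) ≫ φ (n + 1))

end


/-- The lift `ℓ` of `X` along the derived functor is (isomorphic to) the one that is given by the
lift `K` of an injective resolution of `X`. -/
def ComplexLift.Realizes [EnoughInjectives Cb] [HasDerivedCategory Cb] [HasDerivedCategory C]
    {i : C ⥤ Cb} [IsAbelianDeformation Rb R i] {X : DerivedCategory.Plus C}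
    {E : BddInjectiveResolution X} (K : ComplexLift Rb R i E.complex)
    (ℓ : Lift (rHom Rb R R i) X) : Prop :=
  ∃ e : DerivedCategory.Plus.Q.obj K.complex ≅ ℓ.obj,
    E.iso.hom ≫ ℓ.iso.hom =
      DerivedCategory.Plus.Q.map K.iso.hom ≫ derivedUnit (homFunctor Rb R R i) K.complex ≫
        (rHom Rb R R i).map e.hom

end Deformation

end DerivedLifting

open DerivedLifting

set_option linter.unusedSectionVars false

namespace DerivedLifting

/-! ### Deformations along a surjection `A → B` and the functor `Hom_A(B, -)` -/

section DeformationBasics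

variable (A B : Type*) [CommRing A] [CommRing B] [Algebra A B]
  {D D₀ : Type*} [Category D] [Category D₀]

section Preadditive

variable [Preadditive D] [Linear A D] [Preadditive D₀] [Linear B D₀]
  (i : D₀ ⥤ D) [IsAbelianDeformation A B i]

include A B

/-! Since `J` lies in `I`, the condition `I * J = 0` makes `J` an ideal of square zero. Write `F`
for `Hom_Rb(R, -)`; then `F Xb` is the largest subobject of `Xb` killed by `J`. On injectives `F`
behaves like reduction modulo a square zero ideal. It is full on morphisms into injectives, and
composable morphisms that it kills have composite zero (`comp_eq_zero_of_homFunctor_map_eq_zero`).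
So an endomorphism that `F` sends to the identity is invertible, and lifting of idempotents shows
that every injective of `C` lifts (`exists_injective_lift`).

Flatness identifies the morphisms killed by `F`. For an injective, hence coflat, lift `Eb` of `E`,
the map `Eb ⟶ Hom_Rb(J, Eb) = Hom_R(J, E)` is epi and its kernel is the part killed by `J`. A
morphism `Eb ⟶ Eb'` killed by `F` therefore factors through it, and its image lands in the largest
subobject of `Eb'` that comes from `C₀`, which is `Hom_R(S, E')` (`kerMap_injective`,
`IsLiftOf.exists_kerMap_eq`). Thus cochains from `Hom_R(J, E)` to `Hom_R(S, E')` are the graded maps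
that lift zero, and their differential is the commutator with any lifts of the differentials
(`GradedLift.kerCochain_δ`).

The rest is classical obstruction theory. A lift `d` of the differential commutes with `d²`, so `d²`
is a cocycle. As kernel maps have product zero, `(d + g)² = d² + δ g` (`GradedLift.perturb_comp`): a
correction `g` exists exactly when the class vanishes, and the corrections that preserve square zero
are the 1-cocycles.

To pass to derived categories, note that `Hom_R(S, -)` preserves injectives, so cohomology classes
are the same as morphisms in `D(C₀)` (`BddInjectiveResolution.cls_eq_zero_iff`,
`BddInjectiveResolution.cls_surjective`). Two points need care. A lift in the derived category is
realized by a lift of complexes only over a resolution adapted to it, so differences are formed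
along maps between resolutions and shown to be independent of all choices
(`GradedLift.IsDifferenceAlong.sub_mem_coboundaries`). And a vanishing difference only yields
morphisms of lifts in both directions; these are isomorphisms because an endomorphism that `RF`
sends to the identity is invertible (`isIso_of_rHom_map_eq_id`). -/

lemma IsAbelianDeformation.map_injective {X Y : D₀} {f g : X ⟶ Y} (h : i.map f = i.map g) :
    f = g := by
  have := IsAbelianDeformation.isEquivalence (R := A) (S := B) (i := i)
  exact (toScalarObj A B i).map_injective (ScalarObj.Hom.ext h)

/-- Each scalar of `B` comes from `A`, so compatibility with the action of `B` is automatic by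
`A`-linearity. -/
lemma IsAbelianDeformation.exists_map_eq (hs : Function.Surjective (algebraMap A B))
    {X Y : D₀} (f : i.obj X ⟶ i.obj Y) : ∃ g, i.map g = f := by
  have := IsAbelianDeformation.isEquivalence (R := A) (S := B) (i := i)
  have hf : ∀ b : B, ((toScalarObj A B i).obj X).act b ≫ f =
      f ≫ ((toScalarObj A B i).obj Y).act b := by
    intro b
    obtain ⟨a, rfl⟩ := hs b
    change i.map (algebraMap A B a • 𝟙 X) ≫ f = f ≫ i.map (algebraMap A B a • 𝟙 Y)
    simp [IsLinearAlong.map_algebraMap_smul (R := A) (S := B) (i := i)]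
  obtain ⟨g, hg⟩ := (toScalarObj A B i).map_surjective (⟨f, hf⟩ :
    (toScalarObj A B i).obj X ⟶ (toScalarObj A B i).obj Y)
  exact ⟨g, congrArg ScalarObj.Hom.hom hg⟩

lemma IsAbelianDeformation.smul_id_eq_zero (Y : D₀) {a : A}
    (ha : algebraMap A B a = 0) : a • 𝟙 (i.obj Y) = 0 := by
  rw [← i.map_id, ← IsLinearAlong.map_algebraMap_smul (R := A) (S := B) (i := i), ha, zero_smul,
    i.map_zero]

/-- The action of `A` on `Z` factors through the surjection to `B`. Together with full faithfulness
this identifies `D₀` with the full subcategory of the objects of `D` that the kernel of `A → B`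
kills. -/
lemma IsAbelianDeformation.exists_iso_of_smul_id_eq_zero
    (hs : Function.Surjective (algebraMap A B)) (Z : D)
    (hZ : ∀ a : A, algebraMap A B a = 0 → a • 𝟙 Z = 0) : ∃ Y : D₀, Nonempty (i.obj Y ≅ Z) := by
  have := IsAbelianDeformation.isEquivalence (R := A) (S := B) (i := i)
  let act₀ : B →+* End Z := RingHom.liftOfSurjective (algebraMap A B) hs
    ⟨algebraMap A (End Z), fun a ha => by
      rw [RingHom.mem_ker] at ha ⊢
      rw [Algebra.algebraMap_eq_smul_one]
      exact hZ a ha⟩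
  let W : ScalarObj A B D :=
    { obj := Z
      act := { act₀ with
        commutes' := fun a => RingHom.liftOfRightInverse_comp_apply _ _
          (Function.rightInverse_surjInv hs) _ a } }
  let e := (toScalarObj A B i).objObjPreimageIso W
  exact ⟨(toScalarObj A B i).objPreimage W, ⟨⟨e.hom.hom, e.inv.hom,
    congrArg ScalarObj.Hom.hom e.hom_inv_id, congrArg ScalarObj.Hom.hom e.inv_hom_id⟩⟩⟩

end Preadditive

section HomFunctor

variable [Abelian D] [Linear A D] [Preadditive D₀] [Linear B D₀]
  (i : D₀ ⥤ D) [IsAbelianDeformation A B i]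
  (M : Type*) [AddCommGroup M] [Module A M] [Module B M] [IsScalarTower A B M]
  [Module.FinitePresentation A M]

/-- The isomorphism between (the image in `D` of) `Hom_A(M, X)` in `D₀` and `Hom_A(M, X)` in `D`. -/
noncomputable def homFunctorObjIso (X : D) :
    i.obj ((homFunctor A B M i).obj X) ≅ (homObj A M X).obj where
  hom := ScalarObj.Hom.hom ((deformationEquiv A B i).counit.app ((homScalar A B M).obj X))
  inv := ScalarObj.Hom.hom ((deformationEquiv A B i).counitInv.app ((homScalar A B M).obj X))
  hom_inv_id := congrArg ScalarObj.Hom.hom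
    ((deformationEquiv A B i).counitIso.hom_inv_id_app ((homScalar A B M).obj X))
  inv_hom_id := congrArg ScalarObj.Hom.hom
    ((deformationEquiv A B i).counitIso.inv_hom_id_app ((homScalar A B M).obj X))

lemma homFunctorEv_eq (X : D) (m : M) :
    homFunctorEv A B M i X m = (homFunctorObjIso A B i M X).hom ≫ (homObj A M X).ev m := rfl

lemma homFunctorEv_add (X : D) (m n : M) :
    homFunctorEv A B M i X (m + n) = homFunctorEv A B M i X m + homFunctorEv A B M i X n := by
  simp [homFunctorEv_eq]

lemma homFunctorEv_smul (X : D) (a : A) (m : M) :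
    homFunctorEv A B M i X (a • m) = a • homFunctorEv A B M i X m := by
  simp [homFunctorEv_eq]

variable {M} in
lemma homFunctorEv_hom_ext {Z X : D} {h h' : Z ⟶ i.obj ((homFunctor A B M i).obj X)}
    (w : ∀ m, h ≫ homFunctorEv A B M i X m = h' ≫ homFunctorEv A B M i X m) : h = h' := by
  rw [← cancel_mono (homFunctorObjIso A B i M X).hom]
  refine HomObj.hom_ext _ fun m => ?_
  simpa [homFunctorEv_eq] using w m

variable {M} in
lemma exists_comp_homFunctorEv {Z X : D} (φ : M →ₗ[A] (Z ⟶ X)) :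
    ∃ h : Z ⟶ i.obj ((homFunctor A B M i).obj X), ∀ m, h ≫ homFunctorEv A B M i X m = φ m :=
  ⟨(homObj A M X).lift φ ≫ (homFunctorObjIso A B i M X).inv, fun m => by simp [homFunctorEv_eq]⟩

lemma map_homFunctor_map_ev {X X' : D} (f : X ⟶ X') (m : M) :
    i.map ((homFunctor A B M i).map f) ≫ homFunctorEv A B M i X' m =
      homFunctorEv A B M i X m ≫ f := by
  have h : i.map ((homFunctor A B M i).map f) ≫ (homFunctorObjIso A B i M X').hom =
      (homFunctorObjIso A B i M X).hom ≫ homMapRight A M f :=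
    congrArg ScalarObj.Hom.hom ((deformationEquiv A B i).counit.naturality
      ((homScalar A B M).map f))
  rw [homFunctorEv_eq, homFunctorEv_eq, ← Category.assoc, h]
  simp

end HomFunctor

section Coinduced

variable [Abelian D] [Linear A D]

section

variable [Module.FinitePresentation A B] [Preadditive D₀] [Linear B D₀] (i : D₀ ⥤ D) [IsAbelianDeformation A B i]

lemma homFunctorEv_self (hs : Function.Surjective (algebraMap A B)) (X : D) (b : B) :
    ∃ a : A, homFunctorEv A B B i X b = a • homFunctorEv A B B i X 1 := by
  obtain ⟨a, rfl⟩ := hs b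
  exact ⟨a, by rw [← homFunctorEv_smul, Algebra.algebraMap_eq_smul_one]⟩

/-- All evaluations are `A`-multiples of the evaluation at `1`, so `Hom_A(B, X)` is a subobject of
`X`. -/
lemma mono_homFunctorEv_one (hs : Function.Surjective (algebraMap A B)) (X : D) :
    Mono (homFunctorEv A B B i X 1) where
  right_cancellation g h w := by
    refine homFunctorEv_hom_ext A B i fun b => ?_
    obtain ⟨a, ha⟩ := homFunctorEv_self A B i hs X b
    rw [ha, Linear.comp_smul, Linear.comp_smul, w]

/-- The map `a ↦ a • f` descends to `B`. Hence `Hom_A(B, X)` is the largest subobject of `X` killed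
by the kernel of `A → B`. -/
lemma exists_comp_homFunctorEv_one (hs : Function.Surjective (algebraMap A B)) {Z X : D}
    (f : Z ⟶ X) (hf : ∀ a : A, algebraMap A B a = 0 → a • f = 0) :
    ∃ h : Z ⟶ i.obj ((homFunctor A B B i).obj X), h ≫ homFunctorEv A B B i X 1 = f := by
  let ψ : B →ₗ[A] (Z ⟶ X) :=
    (LinearMap.ker (Algebra.linearMap A B)).liftQ (LinearMap.toSpanSingleton A _ f)
        (fun a ha => hf a ha) ∘ₗ
      ((Algebra.linearMap A B).quotKerEquivOfSurjective hs).symm.toLinearMap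
  obtain ⟨h, hh⟩ := exists_comp_homFunctorEv A B i ψ
  refine ⟨h, ?_⟩
  rw [hh]
  have : ((Algebra.linearMap A B).quotKerEquivOfSurjective hs).symm 1 =
      Submodule.Quotient.mk 1 := by
    rw [LinearEquiv.symm_apply_eq]
    exact (map_one (algebraMap A B)).symm
  rw [LinearMap.comp_apply, LinearEquiv.coe_coe, this]
  exact one_smul A f

/-- The existence half of the adjunction between `i` and `Hom_A(B, -)`, with the evaluation at `1`
as counit. -/
lemma exists_map_comp_homFunctorEv_one (hs : Function.Surjective (algebraMap A B)) {Y : D₀} {X : D}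
    (f : i.obj Y ⟶ X) :
    ∃ g : Y ⟶ (homFunctor A B B i).obj X, i.map g ≫ homFunctorEv A B B i X 1 = f := by
  obtain ⟨h, hh⟩ := exists_comp_homFunctorEv_one A B i hs f fun a ha => by
    rw [← Category.id_comp f, ← Linear.smul_comp,
      IsAbelianDeformation.smul_id_eq_zero A B i Y ha, zero_comp]
  obtain ⟨g, rfl⟩ := IsAbelianDeformation.exists_map_eq A B i hs h
  exact ⟨g, hh⟩

lemma homFunctor_map_eq_iff (hs : Function.Surjective (algebraMap A B)) {X Y : D}
    (f : X ⟶ Y) (g : (homFunctor A B B i).obj X ⟶ (homFunctor A B B i).obj Y) :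
    (homFunctor A B B i).map f = g ↔
      homFunctorEv A B B i X 1 ≫ f = i.map g ≫ homFunctorEv A B B i Y 1 := by
  rw [← map_homFunctor_map_ev]
  have := mono_homFunctorEv_one A B i hs Y
  rw [cancel_mono]
  exact ⟨fun h => h ▸ rfl, fun h => IsAbelianDeformation.map_injective A B i h⟩

lemma homFunctor_map_eq_zero_iff (hs : Function.Surjective (algebraMap A B)) {X Y : D}
    (f : X ⟶ Y) : (homFunctor A B B i).map f = 0 ↔ homFunctorEv A B B i X 1 ≫ f = 0 := by
  rw [homFunctor_map_eq_iff A B i hs, i.map_zero, zero_comp]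

/-- If the kernel of `A → B` has square zero, so has the ideal of the morphisms that
`Hom_A(B, -)` sends to zero. -/
lemma comp_eq_zero_of_homFunctor_map_eq_zero (hs : Function.Surjective (algebraMap A B))
    (hk : ∀ a b : A, algebraMap A B a = 0 → algebraMap A B b = 0 → a * b = 0) {X Y Z : D}
    (f : X ⟶ Y) (g : Y ⟶ Z) (hf : (homFunctor A B B i).map f = 0)
    (hg : (homFunctor A B B i).map g = 0) : f ≫ g = 0 := by
  rw [homFunctor_map_eq_zero_iff A B i hs] at hf hg
  -- For `a` in the kernel, `a • 𝟙 X` is killed by the kernel and so factors through the subobject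
  -- `Hom_A(B, X)`, where `f` vanishes. Hence `a • f = 0`, and `f` lands in `Hom_A(B, Y)`, where `g`
  -- vanishes.
  obtain ⟨v, hv⟩ := exists_comp_homFunctorEv_one A B i hs f fun a ha => by
    obtain ⟨u, hu⟩ := exists_comp_homFunctorEv_one A B i hs (a • 𝟙 X) fun b hb => by
      rw [smul_smul, hk b a hb ha, zero_smul]
    rw [← Category.id_comp f, ← Linear.smul_comp, ← hu, Category.assoc, hf, comp_zero]
  rw [← hv, Category.assoc, hg, comp_zero]

/-- A morphism given on the subobject `Hom_A(B, X)` extends to `X` because the target is injective.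
-/
lemma exists_homFunctor_map_eq (hs : Function.Surjective (algebraMap A B)) {X Y : D} [Injective Y]
    (g : (homFunctor A B B i).obj X ⟶ (homFunctor A B B i).obj Y) :
    ∃ f : X ⟶ Y, (homFunctor A B B i).map f = g := by
  have := mono_homFunctorEv_one A B i hs X
  refine ⟨Injective.factorThru (i.map g ≫ homFunctorEv A B B i Y 1)
    (homFunctorEv A B B i X 1), ?_⟩
  rw [homFunctor_map_eq_iff A B i hs, Injective.comp_factorThru]

lemma isIso_of_isIso_homFunctor_map (hs : Function.Surjective (algebraMap A B))
    (hk : ∀ a b : A, algebraMap A B a = 0 → algebraMap A B b = 0 → a * b = 0) {X : D}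
    (f : X ⟶ X) (hf : (homFunctor A B B i).map f = 𝟙 _) : IsIso f := by
  have h : (f - 𝟙 X) ≫ (f - 𝟙 X) = 0 := by
    have : (homFunctor A B B i).map (f - 𝟙 X) = 0 := by
      rw [Functor.map_sub, hf, CategoryTheory.Functor.map_id, sub_self]
    exact comp_eq_zero_of_homFunctor_map_eq_zero A B i hs hk _ _ this this
  simp only [Preadditive.comp_sub, Preadditive.sub_comp, Category.comp_id, Category.id_comp] at h
  -- With `n = f - 𝟙` and `n² = 0`, the inverse of `𝟙 + n` is `𝟙 - n`.
  refine ⟨𝟙 X + 𝟙 X - f, ?_, ?_⟩ <;>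
  · simp only [Preadditive.comp_sub, Preadditive.sub_comp, Preadditive.comp_add,
      Preadditive.add_comp, Category.comp_id, Category.id_comp]
    rw [← sub_eq_zero, ← neg_eq_zero, ← h]
    abel

end

section

variable [Abelian D₀] [Linear B D₀] (i : D₀ ⥤ D) [IsAbelianDeformation A B i]

include A B in
-- The kernel of `i.map f` is a subobject of `i.obj X`, so the kernel of `A → B` kills it and it
-- comes from `D₀`, where `f` is mono.
lemma IsAbelianDeformation.mono_map (hs : Function.Surjective (algebraMap A B)) {X Y : D₀}
    (f : X ⟶ Y) [Mono f] : Mono (i.map f) := by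
  refine Preadditive.mono_of_kernel_zero ?_
  obtain ⟨K, ⟨e⟩⟩ := IsAbelianDeformation.exists_iso_of_smul_id_eq_zero A B i hs
    (kernel (i.map f)) fun a ha => by
      rw [← cancel_mono (kernel.ι (i.map f)), zero_comp, Linear.smul_comp, Category.id_comp,
        ← Category.comp_id (kernel.ι (i.map f)), ← Linear.comp_smul,
        IsAbelianDeformation.smul_id_eq_zero A B i X ha, comp_zero]
  obtain ⟨k, hk⟩ := IsAbelianDeformation.exists_map_eq A B i hs (e.hom ≫ kernel.ι (i.map f))
  have : k = 0 := by
    rw [← cancel_mono f, zero_comp]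
    apply IsAbelianDeformation.map_injective A B i
    rw [i.map_comp, hk, Category.assoc, kernel.condition, comp_zero, i.map_zero]
  rw [← cancel_epi e.hom, ← hk, this, i.map_zero, comp_zero]

variable [Module.FinitePresentation A B]

/-- A right adjoint of a functor that preserves monomorphisms preserves injectives. -/
lemma injective_homFunctor_obj (hs : Function.Surjective (algebraMap A B)) (X : D) [Injective X] :
    Injective ((homFunctor A B B i).obj X) where
  factors {Y Z} g f _ := by
    have := IsAbelianDeformation.mono_map A B i hs f
    have := mono_homFunctorEv_one A B i hs X
    obtain ⟨h, hh⟩ := exists_map_comp_homFunctorEv_one A B i hs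
      (Injective.factorThru (i.map g ≫ homFunctorEv A B B i X 1) (i.map f))
    refine ⟨h, IsAbelianDeformation.map_injective A B i ?_⟩
    rw [← cancel_mono (homFunctorEv A B B i X 1), i.map_comp, Category.assoc, hh,
      Injective.comp_factorThru]

/-- Injective objects lift along `Hom_A(B, -)` if the kernel of `A → B` has square zero. -/
lemma exists_injective_lift [EnoughInjectives D] (hs : Function.Surjective (algebraMap A B))
    (hk : ∀ a b : A, algebraMap A B a = 0 → algebraMap A B b = 0 → a * b = 0) (E : D₀)
    [Injective E] :
    ∃ X : D, Injective X ∧ Nonempty (E ≅ (homFunctor A B B i).obj X) := by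
  let X := Injective.under (i.obj E)
  obtain ⟨u, hu⟩ := exists_map_comp_homFunctorEv_one A B i hs (Injective.ι (i.obj E))
  have : Mono u := by
    refine Preadditive.mono_of_cancel_zero _ fun {Y} g hg => ?_
    apply IsAbelianDeformation.map_injective A B i
    rw [i.map_zero, ← cancel_mono (Injective.ι (i.obj E)), ← hu, ← Category.assoc, ← i.map_comp,
      hg, i.map_zero, zero_comp, zero_comp]
  let r := Injective.factorThru (𝟙 E) u
  have hur : u ≫ r = 𝟙 E := Injective.comp_factorThru _ _
  -- The split mono `u` exhibits `E` as the image of the idempotent `r ≫ u` on `Hom_A(B, X)`. The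
  -- kernel of `φ` is nil, so this idempotent lifts to `X`, and the summand of `X` that the lift
  -- splits off is the required injective.
  let φ : End X →+* End ((homFunctor A B B i).obj X) :=
    { (homFunctor A B B i).mapEnd X with
      map_zero' := (homFunctor A B B i).map_zero X X
      map_add' := fun _ _ => (homFunctor A B B i).map_add }
  have hφ : ∀ x ∈ RingHom.ker φ, IsNilpotent x := fun x hx =>
    ⟨2, by
      rw [pow_two]
      exact comp_eq_zero_of_homFunctor_map_eq_zero A B i hs hk x x hx hx⟩
  obtain ⟨p, hp, hpr⟩ := exists_isIdempotentElem_eq_of_ker_isNilpotent φ hφ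
    (show End ((homFunctor A B B i).obj X) from r ≫ u)
    (exists_homFunctor_map_eq A B i hs _)
    (show (r ≫ u) ≫ (r ≫ u) = r ≫ u by rw [Category.assoc, reassoc_of% hur])
  obtain ⟨Y, s, e, hse, hes⟩ := (Idempotents.isIdempotentComplete_of_abelian D).idempotents_split
    X p hp
  have hpr' : (homFunctor A B B i).map (e ≫ s) = r ≫ u := by rw [hes]; exact hpr
  refine ⟨Y, (Retract.mk s e hse).injective, ⟨⟨u ≫ (homFunctor A B B i).map e,
    (homFunctor A B B i).map s ≫ r, ?_, ?_⟩⟩⟩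
  · rw [Category.assoc, ← Functor.map_comp_assoc, hpr', Category.assoc, hur, Category.comp_id, hur]
  · rw [Category.assoc, ← reassoc_of% hpr', ← Functor.map_comp, ← Functor.map_comp, Category.assoc,
      hse, Category.comp_id, hse, CategoryTheory.Functor.map_id]

end

end Coinduced

end DeformationBasics


/-- Joint monicity, known only for test objects of `D₀`, extends to test objects of `D`, because the
image of `d` is a subobject of `i.obj V` and so comes from `D₀`. -/
lemma IsAbelianDeformation.eq_zero_of_jointly_mono (A B : Type*) [CommRing A] [CommRing B]
    [Algebra A B] {D D₀ : Type*} [Category D] [Category D₀] [Abelian D] [Linear A D]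
    [Preadditive D₀] [Linear B D₀] (i : D₀ ⥤ D) [IsAbelianDeformation A B i]
    (hs : Function.Surjective (algebraMap A B)) {V : D₀} {ι : Type*} {X : ι → D₀}
    (f : ∀ k, V ⟶ X k) (hf : ∀ (V' : D₀) (g : V' ⟶ V), (∀ k, g ≫ f k = 0) → g = 0)
    {Z : D} (d : Z ⟶ i.obj V) (hd : ∀ k, d ≫ i.map (f k) = 0) : d = 0 := by
  obtain ⟨V', ⟨e⟩⟩ := IsAbelianDeformation.exists_iso_of_smul_id_eq_zero A B i hs
    (Abelian.image d) fun a ha => by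
      rw [← cancel_mono (Abelian.image.ι d), zero_comp, Linear.smul_comp, Category.id_comp,
        ← Category.comp_id (Abelian.image.ι d), ← Linear.comp_smul,
        IsAbelianDeformation.smul_id_eq_zero A B i V ha, comp_zero]
  obtain ⟨m, hm⟩ := IsAbelianDeformation.exists_map_eq A B i hs (e.hom ≫ Abelian.image.ι d)
  have hm0 : m = 0 := by
    refine hf _ _ fun k => IsAbelianDeformation.map_injective A B i ?_
    have h : Abelian.image.ι d ≫ i.map (f k) = 0 := by
      rw [← cancel_epi (Abelian.factorThruImage d), ← Category.assoc, Abelian.image.fac, hd,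
        comp_zero]
    rw [i.map_comp, hm, Category.assoc, h, comp_zero, i.map_zero]
  have h : Abelian.image.ι d = 0 := by
    rw [← cancel_epi e.hom, ← hm, hm0, i.map_zero, comp_zero]
  rw [← Abelian.image.fac d, h, comp_zero]

/-! ### Morphisms killed by `Hom_Rb(R, -)` -/

section KernelMaps

variable (Rb R S : Type*) [CommRing Rb] [CommRing R] [CommRing S] [Algebra Rb R] [Algebra R S]

/-- As `J` lies in `I`, the square of `J` lies in `I * J = 0`. -/
lemma SmallExtension.mul_eq_zero [SmallExtension Rb R S] (a b : Rb)
    (ha : algebraMap Rb R a = 0) (hb : algebraMap Rb R b = 0) : a * b = 0 := by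
  rw [← Ideal.mem_bot, ← SmallExtension.mul_eq_bot (Rb := Rb) (R := R) (S := S)]
  refine Ideal.mul_mem_mul ?_ hb
  rw [RingHom.mem_ker, RingHom.comp_apply, ha, map_zero]

variable [IsCoherentRing Rb] [Module.FinitePresentation Rb R] [Module.FinitePresentation R S]
  [SmallExtension Rb R S]
  {Cb C C₀ : Type*} [Category Cb] [Category C] [Category C₀] [Abelian Cb] [Abelian C] [Abelian C₀]
  [Linear Rb Cb] [Linear R C] [Linear S C₀]
  (i : C ⥤ Cb) [IsAbelianDeformation Rb R i] (i₀ : C₀ ⥤ C) [IsAbelianDeformation R S i₀]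

include S in
lemma mono_map_hom_comp_homFunctorEv_one {E : C} {Eb : Cb}
    (c : E ≅ (homFunctor Rb R R i).obj Eb) : Mono (i.map c.hom ≫ homFunctorEv Rb R R i Eb 1) := by
  have := mono_homFunctorEv_one Rb R i (SmallExtension.surjective_left S) Eb
  infer_instance

/-- Multiplication by the elements of `J` is a map `q` from `Eb` to `Hom_Rb(J, Eb)`. This target is
killed by `J`, so it comes from an object of `C`, whose evaluations factor through `E`; that gives
the map `t` to `Hom_R(J, E)`. If `Eb` is coflat, exactness on `J → Rb → Rb ⧸ J` makes `q` epi. -/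
lemma exists_kerProj {E : C} {Eb : Cb} (c : E ≅ (homFunctor Rb R R i).obj Eb) :
    ∃ p : Eb ⟶ i.obj (i₀.obj ((homFunctor R S (RelKernel Rb R S) i₀).obj E)),
      (∀ j : RelKernel Rb R S,
        p ≫ i.map (homFunctorEv R S (RelKernel Rb R S) i₀ E j) ≫ i.map c.hom ≫
          homFunctorEv Rb R R i Eb 1 = RelKernel.incl Rb R S j • 𝟙 Eb) ∧
      (IsCoflat Rb Eb → Epi p) := by
  have hs := SmallExtension.surjective_left (Rb := Rb) (R := R) S
  have hs' := SmallExtension.surjective_right (R := R) (S := S) Rb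
  have hk := SmallExtension.mul_eq_zero Rb R S
  have hfg : (RingHom.ker (algebraMap Rb R)).FG :=
    Module.FinitePresentation.fg_ker (Algebra.linearMap Rb R) hs
  have hfp := IsCoherentRing.finitePresentation_of_fg _ hfg
  have := mono_map_hom_comp_homFunctorEv_one Rb R S i c
  set J := RingHom.ker (algebraMap Rb R) with hJ
  let W := homObj Rb J Eb
  let q : Eb ⟶ W.obj := W.lift ((LinearMap.toSpanSingleton Rb (Eb ⟶ Eb) (𝟙 Eb)) ∘ₗ J.subtype)
  have hq : ∀ j, q ≫ W.ev j = j.1 • 𝟙 Eb := fun j => by simp [q]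
  obtain ⟨W', ⟨e⟩⟩ := IsAbelianDeformation.exists_iso_of_smul_id_eq_zero Rb R i hs W.obj
    fun a ha => W.hom_ext fun j => by
      have : a • j = 0 := Subtype.ext (hk a j.1 ha j.2)
      rw [Linear.smul_comp, Category.id_comp, ← map_smul, this, map_zero, zero_comp]
  -- The ideal occurs both as an `R`-module and as an `Rb`-module; `ι` keeps the two structures
  -- apart.
  obtain ⟨ι, hι, hιs⟩ : ∃ ι : RelKernel Rb R S ≃+ J, (∀ j, RelKernel.incl Rb R S j = (ι j).1) ∧
      ∀ (a : Rb) j, ι (algebraMap Rb R a • j) = a • ι j :=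
    ⟨AddEquiv.refl J, fun _ => rfl, fun a j => RelKernel.smul_eq Rb R S a j⟩
  have hφ : ∀ j : RelKernel Rb R S, ∃ g : W' ⟶ E,
      i.map g ≫ i.map c.hom ≫ homFunctorEv Rb R R i Eb 1 = e.hom ≫ W.ev (ι j) := fun j => by
    obtain ⟨g, hg⟩ := exists_map_comp_homFunctorEv_one Rb R i hs (e.hom ≫ W.ev (ι j))
    refine ⟨g ≫ c.inv, ?_⟩
    rw [← i.map_comp_assoc, Category.assoc, c.inv_hom_id, Category.comp_id, hg]
  choose φ hφ using hφ
  let Φ : RelKernel Rb R S →ₗ[R] (W' ⟶ E) :=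
    { toFun := φ
      map_add' := fun j k => by
        apply IsAbelianDeformation.map_injective Rb R i
        rw [← cancel_mono (i.map c.hom ≫ homFunctorEv Rb R R i Eb 1), i.map_add,
          Preadditive.add_comp, hφ, hφ, hφ, map_add, map_add, Preadditive.comp_add]
      map_smul' := fun r j => by
        obtain ⟨a, rfl⟩ := hs r
        apply IsAbelianDeformation.map_injective Rb R i
        rw [← cancel_mono (i.map c.hom ≫ homFunctorEv Rb R R i Eb 1), RingHom.id_apply,
          IsLinearAlong.map_algebraMap_smul (R := Rb) (S := R) (i := i), Linear.smul_comp, hφ, hφ,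
          hιs, map_smul, Linear.comp_smul] }
  obtain ⟨t, ht⟩ := exists_comp_homFunctorEv R S i₀ Φ
  refine ⟨q ≫ e.inv ≫ i.map t, fun j => ?_, fun hflat => ?_⟩
  · simp only [Category.assoc]
    rw [← i.map_comp_assoc, ht, show i.map (Φ j) ≫ _ = _ from hφ j, e.inv_hom_id_assoc, hq, hι]
  · have hepi : Epi q := by
      have : Module.FinitePresentation Rb (Rb ⧸ J) :=
        Module.finitePresentation_of_surjective J.mkQ J.mkQ_surjective (by rwa [Submodule.ker_mkQ])
      have h := (hflat J Rb (Rb ⧸ J) J.subtype J.mkQ J.injective_subtype J.mkQ_surjective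
        (LinearMap.exact_subtype_mkQ J)).epi_g
      dsimp only at h
      let u : Eb ⟶ (homObj Rb Rb Eb).obj :=
        (homObj Rb Rb Eb).lift (LinearMap.toSpanSingleton Rb (Eb ⟶ Eb) (𝟙 Eb))
      have hu : (homObj Rb Rb Eb).ev 1 ≫ u = 𝟙 _ := by
        refine HomObj.hom_ext _ fun a => ?_
        have ha : (homObj Rb Rb Eb).ev a = a • (homObj Rb Rb Eb).ev 1 := by
          rw [← map_smul, smul_eq_mul, mul_one]
        rw [Category.assoc, HomObj.lift_ev, Category.id_comp, ha]
        simp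
      have hq' : u ≫ homMapLeft Rb J.subtype Eb = q := by
        refine HomObj.hom_ext _ fun j => ?_
        rw [hq, Category.assoc, homMapLeft_ev, HomObj.lift_ev]
        rfl
      have : Epi u := (SplitEpi.mk _ hu).epi
      rw [← hq']
      infer_instance
    -- The comparison in the opposite direction. It provides a section of `t`, which suffices for
    -- `t` to be epi.
    let l : i.obj (i₀.obj ((homFunctor R S (RelKernel Rb R S) i₀).obj E)) ⟶ W.obj :=
      W.lift
        { toFun := fun j => i.map (homFunctorEv R S (RelKernel Rb R S) i₀ E (ι.symm j)) ≫
            i.map c.hom ≫ homFunctorEv Rb R R i Eb 1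
          map_add' := fun j k => by
            rw [← Preadditive.add_comp, ← i.map_add, ← homFunctorEv_add, map_add]
          map_smul' := fun a j => by
            have h : ι.symm (a • j) = algebraMap Rb R a • ι.symm j := by
              rw [AddEquiv.symm_apply_eq, hιs, AddEquiv.apply_symm_apply]
            rw [RingHom.id_apply, ← Linear.smul_comp,
              ← IsLinearAlong.map_algebraMap_smul (R := Rb) (S := R) (i := i),
              ← homFunctorEv_smul, h] }
    have hl : ∀ j, l ≫ W.ev (ι j) = i.map (homFunctorEv R S (RelKernel Rb R S) i₀ E j) ≫
        i.map c.hom ≫ homFunctorEv Rb R R i Eb 1 := fun j => by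
      simp only [l, HomObj.lift_ev, LinearMap.coe_mk, AddHom.coe_mk, AddEquiv.symm_apply_apply]
    obtain ⟨s, hs₁⟩ := IsAbelianDeformation.exists_map_eq Rb R i hs (l ≫ e.inv)
    have hst : s ≫ t = 𝟙 _ := by
      refine homFunctorEv_hom_ext R S i₀ fun j => ?_
      apply IsAbelianDeformation.map_injective Rb R i
      rw [Category.assoc, ht, Category.id_comp,
        ← cancel_mono (i.map c.hom ≫ homFunctorEv Rb R R i Eb 1), i.map_comp, Category.assoc]
      rw [show i.map (Φ j) ≫ _ = _ from hφ j, hs₁, Category.assoc, e.inv_hom_id_assoc, hl]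
    have : Epi (i.map t) := (SplitEpi.mk (i.map s) (by rw [← i.map_comp, hst, i.map_id])).epi
    infer_instance

/-- The canonical map `Eb ⟶ Hom_Rb(J, Eb) = Hom_R(J, E)`, for `E ≅ Hom_Rb(R, Eb)`. -/
noncomputable def kerProj {E : C} {Eb : Cb} (c : E ≅ (homFunctor Rb R R i).obj Eb) :
    Eb ⟶ i.obj (i₀.obj ((homFunctor R S (RelKernel Rb R S) i₀).obj E)) :=
  (exists_kerProj Rb R S i i₀ c).choose

lemma kerProj_ev {E : C} {Eb : Cb} (c : E ≅ (homFunctor Rb R R i).obj Eb)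
    (j : RelKernel Rb R S) :
    kerProj Rb R S i i₀ c ≫ i.map (homFunctorEv R S (RelKernel Rb R S) i₀ E j) ≫ i.map c.hom ≫
      homFunctorEv Rb R R i Eb 1 = RelKernel.incl Rb R S j • 𝟙 Eb :=
  (exists_kerProj Rb R S i i₀ c).choose_spec.1 j

lemma epi_kerProj [IsFlatAbelian Rb Cb] {E : C} {Eb : Cb} [Injective Eb]
    (c : E ≅ (homFunctor Rb R R i).obj Eb) : Epi (kerProj Rb R S i i₀ c) :=
  (exists_kerProj Rb R S i i₀ c).choose_spec.2
    (IsFlatAbelian.isCoflat_of_injective Eb inferInstance)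

variable {i i₀}

/-- This makes the projection in `RepresentsKernelMap` unique, so the choice made in `kerProj` does
not matter. -/
lemma kerProj_hom_ext {E : C} {Eb Z : Cb} (c : E ≅ (homFunctor Rb R R i).obj Eb)
    {p p' : Z ⟶ i.obj (i₀.obj ((homFunctor R S (RelKernel Rb R S) i₀).obj E))}
    (h : ∀ j, p ≫ i.map (homFunctorEv R S (RelKernel Rb R S) i₀ E j) ≫ i.map c.hom ≫
        homFunctorEv Rb R R i Eb 1 =
      p' ≫ i.map (homFunctorEv R S (RelKernel Rb R S) i₀ E j) ≫ i.map c.hom ≫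
        homFunctorEv Rb R R i Eb 1) : p = p' := by
  rw [← sub_eq_zero]
  refine IsAbelianDeformation.eq_zero_of_jointly_mono Rb R i
    (SmallExtension.surjective_left S) (homFunctorEv R S (RelKernel Rb R S) i₀ E)
    (fun V' g hg => homFunctorEv_hom_ext R S i₀ fun m => by rw [hg, zero_comp]) _ fun j => ?_
  have := mono_map_hom_comp_homFunctorEv_one Rb R S i c
  rw [← cancel_mono (i.map c.hom ≫ homFunctorEv Rb R R i Eb 1), zero_comp, Preadditive.sub_comp,
    Preadditive.sub_comp, sub_eq_zero]
  simpa using h j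

/-- The condition that `f : Eb ⟶ Eb'` lifts `f₀ : E ⟶ E'`. -/
def IsLiftOf {Rb R : Type*} [CommRing Rb] [CommRing R] [Algebra Rb R]
    [Module.FinitePresentation Rb R] {Cb C : Type*} [Category Cb] [Category C] [Abelian Cb]
    [Abelian C] [Linear Rb Cb] [Linear R C] {i : C ⥤ Cb} [IsAbelianDeformation Rb R i]
    {E E' : C} {Eb Eb' : Cb} (c : E ≅ (homFunctor Rb R R i).obj Eb)
    (c' : E' ≅ (homFunctor Rb R R i).obj Eb') (f : Eb ⟶ Eb') (f₀ : E ⟶ E') : Prop :=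
  c.hom ≫ (homFunctor Rb R R i).map f = f₀ ≫ c'.hom

namespace IsLiftOf

variable {Rb R}
variable {E E' E'' : C} {Eb Eb' Eb'' : Cb} {c : E ≅ (homFunctor Rb R R i).obj Eb}
  {c' : E' ≅ (homFunctor Rb R R i).obj Eb'} {c'' : E'' ≅ (homFunctor Rb R R i).obj Eb''}
  {f f₁ : Eb ⟶ Eb'} {f₀ f₀₁ : E ⟶ E'} {g : Eb' ⟶ Eb''} {g₀ : E' ⟶ E''}

omit [IsCoherentRing Rb]

lemma id : IsLiftOf c c (𝟙 Eb) (𝟙 E) := by simp [IsLiftOf]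

lemma comp (hf : IsLiftOf c c' f f₀) (hg : IsLiftOf c' c'' g g₀) :
    IsLiftOf c c'' (f ≫ g) (f₀ ≫ g₀) := by
  unfold IsLiftOf at *
  rw [Functor.map_comp, reassoc_of% hf, hg, Category.assoc]

lemma add (hf : IsLiftOf c c' f f₀) (hf₁ : IsLiftOf c c' f₁ f₀₁) :
    IsLiftOf c c' (f + f₁) (f₀ + f₀₁) := by
  unfold IsLiftOf at *
  rw [Functor.map_add, Preadditive.comp_add, Preadditive.add_comp, hf, hf₁]

lemma sub (hf : IsLiftOf c c' f f₀) (hf₁ : IsLiftOf c c' f₁ f₀₁) :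
    IsLiftOf c c' (f - f₁) (f₀ - f₀₁) := by
  unfold IsLiftOf at *
  rw [Functor.map_sub, Preadditive.comp_sub, Preadditive.sub_comp, hf, hf₁]

lemma homFunctor_map_eq_zero (hf : IsLiftOf c c' f 0) : (homFunctor Rb R R i).map f = 0 := by
  rw [← cancel_epi c.hom, comp_zero]
  exact hf.trans zero_comp

end IsLiftOf

variable {Rb R} in
include S in
lemma exists_isLiftOf {E E' : C} {Eb Eb' : Cb} [Injective Eb']
    (c : E ≅ (homFunctor Rb R R i).obj Eb) (c' : E' ≅ (homFunctor Rb R R i).obj Eb')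
    (f₀ : E ⟶ E') : ∃ f, IsLiftOf c c' f f₀ := by
  obtain ⟨f, hf⟩ := exists_homFunctor_map_eq Rb R i (SmallExtension.surjective_left S)
    (c.inv ≫ f₀ ≫ c'.hom)
  exact ⟨f, by rw [IsLiftOf, hf, c.hom_inv_id_assoc]⟩

variable {Rb R} in
-- With `E` viewed as the subobject of `Eb` killed by `J`, a lift of `f₀` restricts to `f₀`.
lemma IsLiftOf.map_comp_ev {E E' : C} {Eb Eb' : Cb} {c : E ≅ (homFunctor Rb R R i).obj Eb}
    {c' : E' ≅ (homFunctor Rb R R i).obj Eb'} {f : Eb ⟶ Eb'} {f₀ : E ⟶ E'}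
    (hf : IsLiftOf c c' f f₀) :
    i.map f₀ ≫ i.map c'.hom ≫ homFunctorEv Rb R R i Eb' 1 =
      i.map c.hom ≫ homFunctorEv Rb R R i Eb 1 ≫ f := by
  rw [← i.map_comp_assoc, ← hf, i.map_comp_assoc, map_homFunctor_map_ev]

/-- Evaluated at `j`, both sides are `j • f`. -/
lemma IsLiftOf.comp_kerProj {E E' : C} {Eb Eb' : Cb} {c : E ≅ (homFunctor Rb R R i).obj Eb}
    {c' : E' ≅ (homFunctor Rb R R i).obj Eb'} {f : Eb ⟶ Eb'} {f₀ : E ⟶ E'}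
    (hf : IsLiftOf c c' f f₀) :
    f ≫ kerProj Rb R S i i₀ c' = kerProj Rb R S i i₀ c ≫
      i.map (i₀.map ((homFunctor R S (RelKernel Rb R S) i₀).map f₀)) := by
  refine kerProj_hom_ext Rb R S c' fun j => ?_
  rw [Category.assoc, kerProj_ev, Category.assoc, ← i.map_comp_assoc, map_homFunctor_map_ev,
    i.map_comp_assoc, hf.map_comp_ev,
    reassoc_of% kerProj_ev Rb R S i i₀ c]
  simp

/-- The map that identifies `Hom(Hom_R(J, E), Hom_R(S, E'))` with the group of the morphisms
`Eb ⟶ Eb'` that `Hom_Rb(R, -)` sends to zero. -/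
noncomputable def kerMap {E E' : C} {Eb Eb' : Cb} (c : E ≅ (homFunctor Rb R R i).obj Eb)
    (c' : E' ≅ (homFunctor Rb R R i).obj Eb')
    (g : (homFunctor R S (RelKernel Rb R S) i₀).obj E ⟶ (homFunctor R S S i₀).obj E') :
    Eb ⟶ Eb' :=
  kerProj Rb R S i i₀ c ≫ i.map (i₀.map g) ≫ i.map (homFunctorEv R S S i₀ E' 1) ≫
    i.map c'.hom ≫ homFunctorEv Rb R R i Eb' 1

variable {E E' E'' : C} {Eb Eb' Eb'' : Cb} (c : E ≅ (homFunctor Rb R R i).obj Eb)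
  (c' : E' ≅ (homFunctor Rb R R i).obj Eb')

lemma representsKernelMap_iff
    (g : (homFunctor R S (RelKernel Rb R S) i₀).obj E ⟶ (homFunctor R S S i₀).obj E')
    (θ : Eb ⟶ Eb') :
    RepresentsKernelMap Rb R S i i₀ c c' g θ ↔ kerMap Rb R S c c' g = θ := by
  constructor
  · rintro ⟨p, hp, rfl⟩
    rw [kerMap, kerProj_hom_ext Rb R S c (p := kerProj Rb R S i i₀ c) (p' := p)]
    intro j
    rw [kerProj_ev, hp]
  · rintro rfl
    exact ⟨_, kerProj_ev Rb R S i i₀ c, rfl⟩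

@[simp]
lemma kerMap_add
    (g g' : (homFunctor R S (RelKernel Rb R S) i₀).obj E ⟶ (homFunctor R S S i₀).obj E') :
    kerMap Rb R S c c' (g + g') = kerMap Rb R S c c' g + kerMap Rb R S c c' g' := by
  simp only [kerMap, Functor.map_add, Preadditive.add_comp, Preadditive.comp_add]

@[simp]
lemma kerMap_sub
    (g g' : (homFunctor R S (RelKernel Rb R S) i₀).obj E ⟶ (homFunctor R S S i₀).obj E') :
    kerMap Rb R S c c' (g - g') = kerMap Rb R S c c' g - kerMap Rb R S c c' g' := by
  simp only [kerMap, Functor.map_sub, Preadditive.sub_comp, Preadditive.comp_sub]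

@[simp]
lemma kerMap_zero :
    kerMap Rb R S c c' (0 : (homFunctor R S (RelKernel Rb R S) i₀).obj E ⟶ _) = 0 := by
  simp only [kerMap, Functor.map_zero, zero_comp, comp_zero]

@[simp]
lemma kerMap_units_smul (u : ℤˣ)
    (g : (homFunctor R S (RelKernel Rb R S) i₀).obj E ⟶ (homFunctor R S S i₀).obj E') :
    kerMap Rb R S c c' (u • g) = u • kerMap Rb R S c c' g := by
  simp only [kerMap, Functor.map_units_smul, Linear.units_smul_comp, Linear.comp_units_smul]

/-- The projection vanishes on the subobject `Hom_Rb(R, Eb)`, since `J` kills it. -/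
lemma isLiftOf_kerMap
    (g : (homFunctor R S (RelKernel Rb R S) i₀).obj E ⟶ (homFunctor R S S i₀).obj E') :
    IsLiftOf c c' (kerMap Rb R S c c' g) 0 := by
  have hs := SmallExtension.surjective_left (Rb := Rb) (R := R) S
  have h : homFunctorEv Rb R R i Eb 1 ≫ kerProj Rb R S i i₀ c = 0 := by
    refine kerProj_hom_ext Rb R S c fun j => ?_
    rw [Category.assoc, kerProj_ev, zero_comp, Linear.comp_smul, Category.comp_id,
      ← Category.id_comp (homFunctorEv Rb R R i Eb 1), ← Linear.smul_comp,
      IsAbelianDeformation.smul_id_eq_zero Rb R i, zero_comp]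
    exact (show RingHom.ker (algebraMap Rb R) from j).2
  have h' : (homFunctor Rb R R i).map (kerMap Rb R S c c' g) = 0 := by
    rw [homFunctor_map_eq_zero_iff Rb R i hs, kerMap, reassoc_of% h, zero_comp]
  rw [IsLiftOf, h', comp_zero, zero_comp]

section

variable [IsFlatAbelian Rb Cb]

/-- By flatness the projection out of `Eb` can be cancelled on the left; the inclusion of `Hom_R(S,
E')` in `Eb'` is always mono. -/
lemma kerMap_injective [Injective Eb] {g g' : (homFunctor R S (RelKernel Rb R S) i₀).obj E ⟶
    (homFunctor R S S i₀).obj E'} (h : kerMap Rb R S c c' g = kerMap Rb R S c c' g') :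
    g = g' := by
  have := epi_kerProj Rb R S i i₀ c
  have := mono_map_hom_comp_homFunctorEv_one Rb R S i c'
  have := mono_homFunctorEv_one R S i₀ (SmallExtension.surjective_right Rb) E'
  have := IsAbelianDeformation.mono_map Rb R i (SmallExtension.surjective_left S)
    (homFunctorEv R S S i₀ E' 1)
  rw [kerMap, kerMap, cancel_epi, cancel_mono] at h
  exact IsAbelianDeformation.map_injective R S i₀ (IsAbelianDeformation.map_injective Rb R i h)

variable {c c'} in
-- The kernel of the projection is killed by `J`, hence lies in `Hom_Rb(R, Eb)`, where `θ` vanishes.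
-- So `θ` factors through the epi projection. The factor has its source in `C₀`, so by adjunction it
-- passes through `E'` and then through `Hom_R(S, E')`.
lemma IsLiftOf.exists_kerMap_eq [Injective Eb] {θ : Eb ⟶ Eb'} (hθ : IsLiftOf c c' θ 0) :
    ∃ g, kerMap Rb R S (i₀ := i₀) c c' g = θ := by
  have hs := SmallExtension.surjective_left (Rb := Rb) (R := R) S
  have hs' := SmallExtension.surjective_right (R := R) (S := S) Rb
  have := epi_kerProj Rb R S i i₀ c
  have h0 : kernel.ι (kerProj Rb R S i i₀ c) ≫ θ = 0 := by
    obtain ⟨h, hh⟩ := exists_comp_homFunctorEv_one Rb R i hs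
      (kernel.ι (kerProj Rb R S i i₀ c)) fun a ha => by
        have := kerProj_ev Rb R S i i₀ c (show RingHom.ker (algebraMap Rb R) from ⟨a, ha⟩)
        have h1 : a • 𝟙 Eb = _ := this.symm
        rw [← Category.comp_id (kernel.ι _), ← Linear.comp_smul, h1, kernel.condition_assoc,
          zero_comp]
    rw [← hh, Category.assoc, (homFunctor_map_eq_zero_iff Rb R i hs θ).1
      hθ.homFunctor_map_eq_zero, comp_zero]
  obtain ⟨v, hv⟩ := exists_map_comp_homFunctorEv_one Rb R i hs
    (Abelian.epiDesc (kerProj Rb R S i i₀ c) θ h0)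
  obtain ⟨g, hg⟩ := exists_map_comp_homFunctorEv_one R S i₀ hs' (v ≫ c'.inv)
  refine ⟨g, ?_⟩
  rw [kerMap, ← i.map_comp_assoc, hg, ← i.map_comp_assoc, Category.assoc, c'.inv_hom_id,
    Category.comp_id, hv, Abelian.comp_epiDesc]

end

variable {c c'} in
-- The composite of a kernel map with a lift depends only on the lifted morphism `f₀`, here and on
-- the other side in `IsLiftOf.kerMap_comp`. This is why the differential of the complex of
-- homomorphisms can be computed with pre-differentials.
lemma IsLiftOf.comp_kerMap {f : Eb ⟶ Eb'} {f₀ : E ⟶ E'} (hf : IsLiftOf c c' f f₀)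
    (c'' : E'' ≅ (homFunctor Rb R R i).obj Eb'')
    (g : (homFunctor R S (RelKernel Rb R S) i₀).obj E' ⟶ (homFunctor R S S i₀).obj E'') :
    f ≫ kerMap Rb R S c' c'' g =
      kerMap Rb R S c c'' ((homFunctor R S (RelKernel Rb R S) i₀).map f₀ ≫ g) := by
  rw [kerMap, reassoc_of% hf.comp_kerProj Rb R S (i₀ := i₀), kerMap, Functor.map_comp, Functor.map_comp,
    Category.assoc]

variable {c c'} in
lemma IsLiftOf.kerMap_comp {f : Eb ⟶ Eb'} {f₀ : E ⟶ E'} (hf : IsLiftOf c c' f f₀)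
    (c'' : E'' ≅ (homFunctor Rb R R i).obj Eb'')
    (g : (homFunctor R S (RelKernel Rb R S) i₀).obj E'' ⟶ (homFunctor R S S i₀).obj E) :
    kerMap Rb R S c'' c g ≫ f =
      kerMap Rb R S c'' c' (g ≫ (homFunctor R S S i₀).map f₀) := by
  simp only [kerMap, Functor.map_comp, Category.assoc]
  rw [← i.map_comp_assoc (i₀.map _) (homFunctorEv R S S i₀ E' 1), map_homFunctor_map_ev,
    i.map_comp_assoc, hf.map_comp_ev]

include S in
lemma IsLiftOf.comp_eq_zero {c : E ≅ (homFunctor Rb R R i).obj Eb}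
    {c' : E' ≅ (homFunctor Rb R R i).obj Eb'} {c'' : E'' ≅ (homFunctor Rb R R i).obj Eb''}
    {f : Eb ⟶ Eb'} {g : Eb' ⟶ Eb''} (hf : IsLiftOf c c' f 0) (hg : IsLiftOf c' c'' g 0) :
    f ≫ g = 0 :=
  comp_eq_zero_of_homFunctor_map_eq_zero Rb R i (SmallExtension.surjective_left S)
    (SmallExtension.mul_eq_zero Rb R S) f g hf.homFunctor_map_eq_zero hg.homFunctor_map_eq_zero

end KernelMaps


/-- The complex obtained by applying an additive functor to a bounded below complex. -/
abbrev mapPlus {C D : Type*} [Category C] [Category D] [Preadditive C] [Preadditive D] (G : C ⥤ D)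
    [G.Additive] (E : CochainComplex.Plus C) : CochainComplex D ℤ :=
  (G.mapCochainComplexPlus.obj E).obj

/-- The map of complexes obtained by applying an additive functor to a map of bounded below
complexes. -/
abbrev mapPlusHom {C D : Type*} [Category C] [Category D] [Preadditive C] [Preadditive D]
    (G : C ⥤ D) [G.Additive] {E E' : CochainComplex.Plus C} (f : E ⟶ E') :
    mapPlus G E ⟶ mapPlus G E' :=
  (G.mapCochainComplexPlus.map f).hom

/-! ### Obstruction and difference cocycles of lifts of complexes -/

section GradedLifts

variable {Rb R S : Type*} [CommRing Rb] [CommRing R] [CommRing S] [Algebra Rb R] [Algebra R S]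
  [IsCoherentRing Rb] [Module.FinitePresentation Rb R] [Module.FinitePresentation R S]
  [SmallExtension Rb R S]
  {Cb C C₀ : Type*} [Category Cb] [Category C] [Category C₀] [Abelian Cb] [Abelian C] [Abelian C₀]
  [Linear Rb Cb] [Linear R C] [Linear S C₀]
  {i : C ⥤ Cb} [IsAbelianDeformation Rb R i] {i₀ : C₀ ⥤ C} [IsAbelianDeformation R S i₀]
  {E E' E'' : CochainComplex.Plus C}

namespace GradedLift

/-- The pre-differential of a graded lift, with an arbitrary target index. -/
noncomputable def dTo (L : GradedLift Rb R i E) (p q : ℤ) (h : p + 1 = q) : L.obj p ⟶ L.obj q :=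
  L.d p ≫ eqToHom (by rw [h])

lemma dTo_self (L : GradedLift Rb R i E) (n : ℤ) : L.dTo n (n + 1) rfl = L.d n := by
  simp [dTo]

lemma isLiftOf_dTo (L : GradedLift Rb R i E) (p q : ℤ) (h : p + 1 = q) :
    IsLiftOf (L.iso p) (L.iso q) (L.dTo p q h) (E.obj.d p q) := by
  subst h
  rw [dTo_self]
  exact L.w p

/-- The pre-differential of a graded lift has square zero. -/
def IsComplex (L : GradedLift Rb R i E) : Prop := ∀ n, L.d n ≫ L.d (n + 1) = 0

lemma IsComplex.dTo_comp_dTo {L : GradedLift Rb R i E} (hL : L.IsComplex) (p q r : ℤ)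
    (hpq : p + 1 = q) (hqr : q + 1 = r) : L.dTo p q hpq ≫ L.dTo q r hqr = 0 := by
  subst hpq hqr
  simpa [dTo_self] using hL p

variable (S) in
include S in
lemma exists_lift_map (L : GradedLift Rb R i E) (L' : GradedLift Rb R i E') (f : E ⟶ E') :
    ∃ φ : ∀ n, L.obj n ⟶ L'.obj n, ∀ n, IsLiftOf (L.iso n) (L'.iso n) (φ n) (f.hom.f n) := by
  have := L'.injective
  choose φ hφ using fun n => exists_isLiftOf S (L.iso n) (L'.iso n) (f.hom.f n)
  exact ⟨φ, hφ⟩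

/-- The graded morphism that is given by a cochain with values in the kernel maps. -/
noncomputable def kerCochain (L : GradedLift Rb R i E) (L' : GradedLift Rb R i E') {n : ℤ}
    (g : Cochain (mapPlus (homFunctor R S (RelKernel Rb R S) i₀) E)
      (mapPlus (homFunctor R S S i₀) E') n) (p q : ℤ) (h : p + n = q) : L.obj p ⟶ L'.obj q :=
  kerMap Rb R S (L.iso p) (L'.iso q) (g.v p q h)

section

variable (L : GradedLift Rb R i E) (L' : GradedLift Rb R i E') {n : ℤ}
  (g g' : Cochain (mapPlus (homFunctor R S (RelKernel Rb R S) i₀) E)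
      (mapPlus (homFunctor R S S i₀) E') n)

lemma isLiftOf_kerCochain (p q : ℤ) (h : p + n = q) :
    IsLiftOf (L.iso p) (L'.iso q) (L.kerCochain L' g p q h) 0 :=
  isLiftOf_kerMap Rb R S _ _ _

@[simp]
lemma kerCochain_zero (p q : ℤ) (h : p + n = q) :
    L.kerCochain L' (0 : Cochain (mapPlus (homFunctor R S (RelKernel Rb R S) i₀) E)
      (mapPlus (homFunctor R S S i₀) E') n) p q h = 0 := kerMap_zero Rb R S _ _

lemma kerCochain_add (p q : ℤ) (h : p + n = q) :
    L.kerCochain L' (g + g') p q h = L.kerCochain L' g p q h + L.kerCochain L' g' p q h :=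
  kerMap_add Rb R S _ _ _ _

lemma kerCochain_sub (p q : ℤ) (h : p + n = q) :
    L.kerCochain L' (g - g') p q h = L.kerCochain L' g p q h - L.kerCochain L' g' p q h :=
  kerMap_sub Rb R S _ _ _ _

/-- Any pre-differentials that lift those of `E` and `E'` may be used; they need not have square
zero. -/
lemma kerCochain_δ (m : ℤ) (hm : n + 1 = m) (p q q₁ q₂ : ℤ) (h : p + m = q) (hq₁ : q₁ + 1 = q)
    (hq₂ : p + 1 = q₂) :
    L.kerCochain L' (δ n m g) p q h =
      L.kerCochain L' g p q₁ (by lia) ≫ L'.dTo q₁ q hq₁ +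
        m.negOnePow • L.dTo p q₂ hq₂ ≫ L.kerCochain L' g q₂ q (by lia) := by
  refine (congrArg (kerMap Rb R S (L.iso p) (L'.iso q))
    (δ_v n m hm g p q h q₁ q₂ (by lia) hq₂)).trans ?_
  exact (kerMap_add Rb R S (L.iso p) (L'.iso q) _ _).trans (congrArg₂ (· + ·)
    ((L'.isLiftOf_dTo q₁ q hq₁).kerMap_comp Rb R S (L.iso p) _).symm
    ((kerMap_units_smul Rb R S (L.iso p) (L'.iso q) _ _).trans (congrArg (m.negOnePow • ·)
      ((L.isLiftOf_dTo p q₂ hq₂).comp_kerMap Rb R S (L'.iso q) _).symm)))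

variable {L L' g g'}

lemma kerCochain_ext [IsFlatAbelian Rb Cb]
    (h : ∀ p q hpq, L.kerCochain L' g p q hpq = L.kerCochain L' g' p q hpq) : g = g' := by
  ext p q hpq
  have := L.injective
  exact kerMap_injective Rb R S (L.iso p) (L'.iso q) (h p q hpq)

variable (S i₀) in
-- With `kerCochain_ext`, this identifies cochains with the graded maps that lift zero, so that
-- cochain identities can be checked on the lifts.
lemma exists_kerCochain [IsFlatAbelian Rb Cb]
    (θ : ∀ p q : ℤ, p + n = q → (L.obj p ⟶ L'.obj q))
    (hθ : ∀ p q h, IsLiftOf (L.iso p) (L'.iso q) (θ p q h) 0) :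
    ∃ g : Cochain (mapPlus (homFunctor R S (RelKernel Rb R S) i₀) E)
      (mapPlus (homFunctor R S S i₀) E') n, ∀ p q h, L.kerCochain L' g p q h = θ p q h := by
  have := L.injective
  choose g hg using fun p q h => (hθ p q h).exists_kerMap_eq Rb R S (i₀ := i₀)
  exact ⟨Cochain.mk g, hg⟩

end

variable (L : GradedLift Rb R i E) (L' : GradedLift Rb R i E') (L'' : GradedLift Rb R i E'')

lemma lift_comp_kerCochain {φ : ∀ n, L.obj n ⟶ L'.obj n} {f : E ⟶ E'}
    (hφ : ∀ n, IsLiftOf (L.iso n) (L'.iso n) (φ n) (f.hom.f n)) {n : ℤ}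
    (g : Cochain (mapPlus (homFunctor R S (RelKernel Rb R S) i₀) E')
      (mapPlus (homFunctor R S S i₀) E'') n) (p q : ℤ) (h : p + n = q) :
    φ p ≫ L'.kerCochain L'' g p q h =
      L.kerCochain L'' ((Cochain.ofHom (mapPlusHom _ f)).comp g (zero_add n)) p q h := by
  exact ((hφ p).comp_kerMap Rb R S (L''.iso q) (g.v p q h)).trans
    (congrArg (kerMap Rb R S (L.iso p) (L''.iso q)) ((Cochain.zero_cochain_comp_v
      (Cochain.ofHom (mapPlusHom (homFunctor R S (RelKernel Rb R S) i₀) f)) g p q h).trans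
        (congrArg (· ≫ g.v p q h) (Cochain.ofHom_v _ p))).symm)

lemma kerCochain_comp_lift {φ : ∀ n, L'.obj n ⟶ L''.obj n} {f : E' ⟶ E''}
    (hφ : ∀ n, IsLiftOf (L'.iso n) (L''.iso n) (φ n) (f.hom.f n)) {n : ℤ}
    (g : Cochain (mapPlus (homFunctor R S (RelKernel Rb R S) i₀) E)
      (mapPlus (homFunctor R S S i₀) E') n) (p q : ℤ) (h : p + n = q) :
    L.kerCochain L' g p q h ≫ φ q =
      L.kerCochain L'' (g.comp (Cochain.ofHom (mapPlusHom _ f)) (add_zero n)) p q h := by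
  exact ((hφ q).kerMap_comp Rb R S (L.iso p) (g.v p q h)).trans
    (congrArg (kerMap Rb R S (L.iso p) (L''.iso q)) ((Cochain.comp_zero_cochain_v
      g (Cochain.ofHom (mapPlusHom (homFunctor R S S i₀) f)) p q h).trans
        (congrArg (g.v p q h ≫ ·) (Cochain.ofHom_v _ q))).symm)

variable {L L' L''}

lemma isSquare_iff (z : Cocycle (mapPlus (homFunctor R S (RelKernel Rb R S) i₀) E)
      (mapPlus (homFunctor R S S i₀) E) 2) :
    L.IsSquare S i₀ z ↔ ∀ p q r (hpq : p + 1 = q) (hqr : q + 1 = r),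
      L.kerCochain L z.1 p r (by lia) = L.dTo p q hpq ≫ L.dTo q r hqr := by
  have h : L.IsSquare S i₀ z ↔
      ∀ n, L.kerCochain L z.1 n (n + 1 + 1) (by lia) = L.d n ≫ L.d (n + 1) :=
    forall_congr' fun n => representsKernelMap_iff Rb R S (L.iso n) (L.iso (n + 1 + 1))
      (z.1.v n (n + 1 + 1) (by lia)) _
  rw [h]
  constructor
  · rintro h p q r rfl rfl
    simpa [dTo_self] using h p
  · intro h n
    simpa [dTo_self] using h n (n + 1) (n + 1 + 1) rfl rfl

lemma isLiftOf_dTo_comp_dTo (L : GradedLift Rb R i E) (p q r : ℤ) (hpq : p + 1 = q)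
    (hqr : q + 1 = r) : IsLiftOf (L.iso p) (L.iso r) (L.dTo p q hpq ≫ L.dTo q r hqr) 0 := by
  simpa using (L.isLiftOf_dTo p q hpq).comp (L.isLiftOf_dTo q r hqr)

variable (S i₀) in
-- The square lifts `d_E² = 0`, and it is a cocycle because `d² d = d d²`.
lemma exists_isSquare [IsFlatAbelian Rb Cb] (L : GradedLift Rb R i E) :
    ∃ z, L.IsSquare S i₀ z := by
  obtain ⟨g, hg⟩ := exists_kerCochain S i₀ (L := L) (L' := L) (n := 2)
    (fun p q h => L.dTo p (p + 1) rfl ≫ L.dTo (p + 1) q (by lia))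
    fun p q h => L.isLiftOf_dTo_comp_dTo p _ q rfl _
  have hg' : ∀ p q r (hpq : p + 1 = q) (hqr : q + 1 = r),
      L.kerCochain L g p r (by lia) = L.dTo p q hpq ≫ L.dTo q r hqr := by
    rintro p q r rfl hqr
    exact hg p r _
  refine ⟨Cocycle.mk g 3 rfl (kerCochain_ext (L := L) (L' := L) fun p q hpq => ?_),
    (isSquare_iff _).2 hg'⟩
  rw [kerCochain_δ L L g 3 rfl p q (p + 1 + 1) (p + 1) hpq (by lia) rfl,
    hg' p (p + 1) _ rfl rfl, hg' (p + 1) (p + 1 + 1) q rfl (by lia), kerCochain_zero,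
    show Int.negOnePow 3 = -1 from rfl]
  simp

/-- For a graded lift `φ` of `f`, the map `β = φ d' - d φ` (composition from left to right) lifts
zero, and `β d' + d β = φ d'² - d² φ`. -/
lemma isSquare_naturality [IsFlatAbelian Rb Cb] (f : E ⟶ E')
    {z : Cocycle (mapPlus (homFunctor R S (RelKernel Rb R S) i₀) E)
      (mapPlus (homFunctor R S S i₀) E) 2}
    {z' : Cocycle (mapPlus (homFunctor R S (RelKernel Rb R S) i₀) E')
      (mapPlus (homFunctor R S S i₀) E') 2}
    (hz : L.IsSquare S i₀ z) (hz' : L'.IsSquare S i₀ z') :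
    z'.precomp (mapPlusHom _ f) - z.postcomp (mapPlusHom _ f) ∈ coboundaries _ _ 2 := by
  rw [isSquare_iff] at hz hz'
  obtain ⟨φ, hφ⟩ := exists_lift_map S L L' f
  obtain ⟨β, hβ⟩ := exists_kerCochain S i₀ (L := L) (L' := L') (n := 1)
    (fun p q h => φ p ≫ L'.dTo p q h - L.dTo p q h ≫ φ q) fun p q h => by
      simpa using ((hφ p).comp (L'.isLiftOf_dTo p q h)).sub ((L.isLiftOf_dTo p q h).comp (hφ q))
  rw [mem_coboundaries_iff _ 1 (one_add_one_eq_two)]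
  refine ⟨β, kerCochain_ext (L := L) (L' := L') fun p q hpq => ?_⟩
  rw [kerCochain_δ L L' β 2 rfl p q (p + 1) (p + 1) hpq (by lia) rfl, hβ, hβ]
  change _ = L.kerCochain L' (_ - _) p q hpq
  rw [kerCochain_sub]
  simp only [Cocycle.precomp_coe, Cocycle.postcomp_coe]
  rw [← lift_comp_kerCochain L L' L' hφ, ← kerCochain_comp_lift L L L' hφ,
    hz p (p + 1) q rfl (by lia), hz' p (p + 1) q rfl (by lia),
    show Int.negOnePow 2 = 1 from rfl]
  simp

variable (L L') in
/-- The degree 1 cochain `z` corresponds to the difference of the differentials of two lifts, where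
the underlying graded objects are compared by a lift of `f`. -/
def IsDifferenceAlong (f : E ⟶ E') (z : Cochain (mapPlus (homFunctor R S (RelKernel Rb R S) i₀) E)
      (mapPlus (homFunctor R S S i₀) E') 1) : Prop :=
  ∃ φ : ∀ n, L.obj n ⟶ L'.obj n,
    (∀ n, IsLiftOf (L.iso n) (L'.iso n) (φ n) (f.hom.f n)) ∧
    ∀ p q h, L.kerCochain L' z p q h = φ p ≫ L'.dTo p q h - L.dTo p q h ≫ φ q

variable (S i₀) in
lemma exists_isDifferenceAlong [IsFlatAbelian Rb Cb] (hL : L.IsComplex) (hL' : L'.IsComplex)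
    (f : E ⟶ E') : ∃ z : Cocycle (mapPlus (homFunctor R S (RelKernel Rb R S) i₀) E)
      (mapPlus (homFunctor R S S i₀) E') 1, L.IsDifferenceAlong L' f z.1 := by
  obtain ⟨φ, hφ⟩ := exists_lift_map S L L' f
  obtain ⟨β, hβ⟩ := exists_kerCochain S i₀ (L := L) (L' := L') (n := 1)
    (fun p q h => φ p ≫ L'.dTo p q h - L.dTo p q h ≫ φ q) fun p q h => by
      simpa using ((hφ p).comp (L'.isLiftOf_dTo p q h)).sub ((L.isLiftOf_dTo p q h).comp (hφ q))
  refine ⟨Cocycle.mk β 2 rfl (kerCochain_ext (L := L) (L' := L') fun p q hpq => ?_), φ, hφ, hβ⟩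
  rw [kerCochain_δ L L' β 2 rfl p q (p + 1) (p + 1) hpq (by lia) rfl, hβ, hβ, kerCochain_zero,
    show Int.negOnePow 2 = 1 from rfl]
  simp [hL'.dTo_comp_dTo, reassoc_of% hL.dTo_comp_dTo]

/-- The Leibniz rule for the commutator of `φ φ'` with the differentials. -/
lemma IsDifferenceAlong.comp {f : E ⟶ E'} {f' : E' ⟶ E''}
    {z : Cochain (mapPlus (homFunctor R S (RelKernel Rb R S) i₀) E)
      (mapPlus (homFunctor R S S i₀) E') 1} (hz : L.IsDifferenceAlong L' f z)
    {z' : Cochain (mapPlus (homFunctor R S (RelKernel Rb R S) i₀) E')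
      (mapPlus (homFunctor R S S i₀) E'') 1} (hz' : L'.IsDifferenceAlong L'' f' z') :
    L.IsDifferenceAlong L'' (f ≫ f')
      (z.comp (Cochain.ofHom (mapPlusHom _ f')) (add_zero 1) +
        (Cochain.ofHom (mapPlusHom _ f)).comp z' (zero_add 1)) := by
  obtain ⟨φ, hφ, hz⟩ := hz
  obtain ⟨φ', hφ', hz'⟩ := hz'
  refine ⟨fun n => φ n ≫ φ' n, fun n => (hφ n).comp (hφ' n), fun p q h => ?_⟩
  rw [kerCochain_add, ← kerCochain_comp_lift L L' L'' hφ', ← lift_comp_kerCochain L L' L'' hφ, hz,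
    hz']
  simp

/-- Subtracting from `φ` the kernel map of `β` does not change what it lifts and removes the
coboundary. -/
lemma IsDifferenceAlong.exists_chain_map {f : E ⟶ E'}
    (β : Cochain (mapPlus (homFunctor R S (RelKernel Rb R S) i₀) E)
      (mapPlus (homFunctor R S S i₀) E') 0) (hz : L.IsDifferenceAlong L' f (δ 0 1 β)) :
    L.IsDifferenceAlong L' f (0 : Cochain (mapPlus (homFunctor R S (RelKernel Rb R S) i₀) E)
      (mapPlus (homFunctor R S S i₀) E') 1) := by
  obtain ⟨φ, hφ, hz⟩ := hz
  refine ⟨fun n => φ n - L.kerCochain L' β n n (add_zero n), fun n => by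
    simpa using (hφ n).sub (L.isLiftOf_kerCochain L' β n n (add_zero n)), fun p q h => ?_⟩
  have := hz p q h
  rw [kerCochain_δ L L' β 1 rfl p q p q h h h, show Int.negOnePow 1 = -1 from rfl] at this
  rw [kerCochain_zero, Preadditive.sub_comp, Preadditive.comp_sub, sub_sub_sub_comm, ← this]
  simp [sub_eq_add_neg]

/-- The graded lift with the pre-differential changed by a cochain. -/
noncomputable def perturb (L : GradedLift Rb R i E)
    (g : Cochain (mapPlus (homFunctor R S (RelKernel Rb R S) i₀) E)
      (mapPlus (homFunctor R S S i₀) E) 1) : GradedLift Rb R i E where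
  obj := L.obj
  injective := L.injective
  iso := L.iso
  d n := L.d n + L.kerCochain L g n (n + 1) rfl
  w n := by
    have h : IsLiftOf _ _ (L.d n) (E.obj.d n (n + 1)) := L.w n
    simpa [IsLiftOf] using h.add (L.isLiftOf_kerCochain L g n (n + 1) rfl)

/-- The quadratic term in `g` vanishes because kernel maps compose to zero, so the condition on `g`
is linear. -/
lemma perturb_comp (L : GradedLift Rb R i E)
    (g : Cochain (mapPlus (homFunctor R S (RelKernel Rb R S) i₀) E)
      (mapPlus (homFunctor R S S i₀) E) 1) (n : ℤ) :
    (L.perturb g).d n ≫ (L.perturb g).d (n + 1) =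
      L.d n ≫ L.d (n + 1) + L.kerCochain L (δ 1 2 g) n (n + 1 + 1) (by lia) := by
  rw [kerCochain_δ L L g 2 rfl n (n + 1 + 1) (n + 1) (n + 1) (by lia) rfl rfl,
    show Int.negOnePow 2 = 1 from rfl]
  change (L.d n + L.kerCochain L g n (n + 1) rfl) ≫
    (L.d (n + 1) + L.kerCochain L g (n + 1) (n + 1 + 1) rfl) = _
  have h : L.kerCochain L g n (n + 1) rfl ≫ L.kerCochain L g (n + 1) (n + 1 + 1) rfl = 0 :=
    (L.isLiftOf_kerCochain L g n (n + 1) rfl).comp_eq_zero Rb R S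
      (L.isLiftOf_kerCochain L g (n + 1) (n + 1 + 1) rfl)
  simp only [Preadditive.add_comp, Preadditive.comp_add, h, dTo_self, one_smul]
  abel

lemma isComplex_perturb_of_cocycle (hL : L.IsComplex)
    (z : Cocycle (mapPlus (homFunctor R S (RelKernel Rb R S) i₀) E)
      (mapPlus (homFunctor R S S i₀) E) 1) : (L.perturb z.1).IsComplex := fun n => by
  rw [perturb_comp, hL, Cocycle.δ_eq_zero, kerCochain_zero, add_zero]
  rfl

lemma isDifferenceAlong_perturb (L : GradedLift Rb R i E)
    (g : Cochain (mapPlus (homFunctor R S (RelKernel Rb R S) i₀) E)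
      (mapPlus (homFunctor R S S i₀) E) 1) : L.IsDifferenceAlong (L.perturb g) (𝟙 E) g := by
  refine ⟨fun n => 𝟙 (L.obj n), fun n => IsLiftOf.id, fun p q h => ?_⟩
  subst h
  rw [dTo_self, dTo_self]
  change L.kerCochain L g p (p + 1) rfl =
    𝟙 (L.obj p) ≫ (L.d p + L.kerCochain L g p (p + 1) rfl : L.obj p ⟶ L.obj (p + 1)) -
      L.d p ≫ 𝟙 (L.obj (p + 1))
  simp

lemma isComplex_perturb_of_isSquare
    {z : Cocycle (mapPlus (homFunctor R S (RelKernel Rb R S) i₀) E)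
      (mapPlus (homFunctor R S S i₀) E) 2} (hz : L.IsSquare S i₀ z)
    {β : Cochain (mapPlus (homFunctor R S (RelKernel Rb R S) i₀) E)
      (mapPlus (homFunctor R S S i₀) E) 1} (hβ : δ 1 2 β = z.1) :
    (L.perturb (-β)).IsComplex := fun n => by
  rw [perturb_comp, δ_neg, hβ]
  rw [isSquare_iff] at hz
  have h := hz n (n + 1) (n + 1 + 1) rfl rfl
  rw [dTo_self, dTo_self] at h
  rw [← h, ← kerCochain_add, add_neg_cancel, kerCochain_zero]
  rfl

/-- The independence of the class of the difference of two lifts of all choices. -/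
lemma IsDifferenceAlong.sub_mem_coboundaries [IsFlatAbelian Rb Cb]
    {E₁ E₂ E₁' E₂' : CochainComplex.Plus C} {L₁ : GradedLift Rb R i E₁} {L₂ : GradedLift Rb R i E₂}
    {L₁' : GradedLift Rb R i E₁'} {L₂' : GradedLift Rb R i E₂'}
    (hL₁ : L₁.IsComplex) (hL₂' : L₂'.IsComplex)
    {f₁ : E₁ ⟶ E₁'} {f₂ : E₂ ⟶ E₂'} {g : E₁ ⟶ E₂} {g' : E₁' ⟶ E₂'}
    {z₁ : Cocycle (mapPlus (homFunctor R S (RelKernel Rb R S) i₀) E₁)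
      (mapPlus (homFunctor R S S i₀) E₁') 1} (hz₁ : L₁.IsDifferenceAlong L₁' f₁ z₁.1)
    {z₂ : Cocycle (mapPlus (homFunctor R S (RelKernel Rb R S) i₀) E₂)
      (mapPlus (homFunctor R S S i₀) E₂') 1} (hz₂ : L₂.IsDifferenceAlong L₂' f₂ z₂.1)
    (hg : L₁.IsDifferenceAlong L₂ g (0 : Cochain
      (mapPlus (homFunctor R S (RelKernel Rb R S) i₀) E₁) (mapPlus (homFunctor R S S i₀) E₂) 1))
    (hg' : L₁'.IsDifferenceAlong L₂' g' (0 : Cochain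
      (mapPlus (homFunctor R S (RelKernel Rb R S) i₀) E₁') (mapPlus (homFunctor R S S i₀) E₂') 1))
    (h : Homotopy (f₁ ≫ g').hom (g ≫ f₂).hom) :
    z₁.postcomp (mapPlusHom _ g') - z₂.precomp (mapPlusHom _ g) ∈ coboundaries _ _ 1 := by
  have hneg : ∀ p q : ℤ, q + 1 = p → p + (-1) = q := by intros; lia
  obtain ⟨φ₁, hφ₁, hz₁⟩ := hz₁
  obtain ⟨φ₂, hφ₂, hz₂⟩ := hz₂
  obtain ⟨ψ, hψ, hψd⟩ := hg
  obtain ⟨ψ', hψ', hψd'⟩ := hg'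
  obtain ⟨η, hη⟩ := Cochain.equivHomotopy _ _ h
  have := L₂'.injective
  -- The homotopy is lifted degree by degree. After subtraction of `k d + d k`, the failure `θ` of
  -- the lifted square to commute lifts zero, so it is a 0-cochain `β`. The correction commutes with
  -- the differentials, as both `L₁` and `L₂'` are complexes, so it does not contribute to `δ β`.
  choose k hk using fun p q (hpq : q + 1 = p) =>
    exists_isLiftOf S (L₁.iso p) (L₂'.iso q) (η.v p q (hneg p q hpq))
  let θ (p : ℤ) : L₁.obj p ⟶ L₂'.obj p := φ₁ p ≫ ψ' p - ψ p ≫ φ₂ p -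
    (k p (p - 1) (sub_add_cancel p 1) ≫ L₂'.dTo (p - 1) p (sub_add_cancel p 1) +
      L₁.dTo p (p + 1) rfl ≫ k (p + 1) p rfl)
  have hθ : ∀ p a b (ha : a + 1 = p) (hb : p + 1 = b), θ p = φ₁ p ≫ ψ' p - ψ p ≫ φ₂ p -
      (k p a ha ≫ L₂'.dTo a p ha + L₁.dTo p b hb ≫ k b p hb) := by
    intro p a b ha hb
    obtain rfl : a = p - 1 := eq_sub_of_add_eq ha
    subst hb
    rfl
  have hθ₀ : ∀ p, IsLiftOf (L₁.iso p) (L₂'.iso p) (θ p) 0 := by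
    intro p
    have h0 := Cochain.congr_v hη p p (add_zero p)
    rw [Cochain.add_v, Cochain.ofHom_v, Cochain.ofHom_v, δ_v (-1) 0 rfl η p p (add_zero p)
      (p - 1) (p + 1) rfl rfl, Int.negOnePow_zero, one_smul, ← sub_eq_iff_eq_add,
      ← sub_eq_zero] at h0
    have h1 := (((hφ₁ p).comp (hψ' p)).sub ((hψ p).comp (hφ₂ p))).sub
      (((hk p (p - 1) (sub_add_cancel p 1)).comp
        (L₂'.isLiftOf_dTo (p - 1) p (sub_add_cancel p 1))).add
        ((L₁.isLiftOf_dTo p (p + 1) rfl).comp (hk (p + 1) p rfl)))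
    rw [← h0]
    exact h1
  obtain ⟨β, hβ⟩ := exists_kerCochain S i₀ (L := L₁) (L' := L₂') (n := 0)
    (fun p q h => θ p ≫ eqToHom (by rw [← h, add_zero])) fun p q h => by
      obtain rfl : p = q := (add_zero p).symm.trans h
      simpa using hθ₀ p
  rw [mem_coboundaries_iff _ 0 (zero_add 1)]
  refine ⟨β, kerCochain_ext (L := L₁) (L' := L₂') fun p q hpq => ?_⟩
  rw [kerCochain_δ L₁ L₂' β 1 rfl p q p q hpq hpq hpq, hβ, hβ,
    hθ p (p - 1) q (sub_add_cancel p 1) hpq, hθ q p (q + 1) hpq rfl, show Int.negOnePow 1 = -1 from rfl]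
  change _ = L₁.kerCochain L₂' (_ - _) p q hpq
  rw [kerCochain_sub]
  simp only [Cocycle.precomp_coe, Cocycle.postcomp_coe]
  rw [← lift_comp_kerCochain L₁ L₂ L₂' hψ, ← kerCochain_comp_lift L₁ L₁' L₂' hψ', hz₁, hz₂]
  have e₁ := hψd p q hpq
  have e₂ := hψd' p q hpq
  rw [kerCochain_zero, eq_comm, sub_eq_zero] at e₁ e₂
  simp only [Preadditive.sub_comp, Preadditive.comp_sub, Preadditive.add_comp,
    Preadditive.comp_add, Category.assoc, eqToHom_refl, Category.comp_id,
    hL₂'.dTo_comp_dTo, reassoc_of% hL₁.dTo_comp_dTo, reassoc_of% e₁, e₂, comp_zero, zero_comp,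
    one_smul, Units.neg_smul]
  abel

/-- The bounded below complex of injectives that is given by a graded lift. -/
noncomputable def toComplexLift (S : Type*) [CommRing S] [Algebra R S] [SmallExtension Rb R S]
    (L : GradedLift Rb R i E) (hL : L.IsComplex) : ComplexLift Rb R i E :=
  -- Where `E` vanishes, the identity of the lift is a lift of zero; being its own square, it is
  -- zero.
  have hzero : CochainComplex.plus Cb (CochainComplex.of L.obj L.d hL) := by
    obtain ⟨n, hn⟩ := E.property
    refine ⟨n, (CochainComplex.isStrictlyGE_iff _ _).2 fun k hk => ?_⟩
    have h0 : 𝟙 (E.obj.X k) = 0 :=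
      (IsZero.iff_id_eq_zero _).1 (E.obj.isZero_of_isStrictlyGE n k hk)
    have h : IsLiftOf (L.iso k) (L.iso k) (𝟙 (L.obj k)) 0 := h0 ▸ IsLiftOf.id
    exact (IsZero.iff_id_eq_zero _).2 (by
      simpa using comp_eq_zero_of_homFunctor_map_eq_zero Rb R i
        (SmallExtension.surjective_left S) (SmallExtension.mul_eq_zero Rb R S) _ _
        h.homFunctor_map_eq_zero h.homFunctor_map_eq_zero)
  { complex := ⟨CochainComplex.of L.obj L.d hL, hzero⟩
    injective := L.injective
    iso := (CochainComplex.Plus.fullyFaithfulι C).preimageIso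
      (HomologicalComplex.Hom.isoOfComponents L.iso (by
        rintro p q (rfl : p + 1 = q)
        exact (congrArg ((L.iso p).hom ≫ (homFunctor Rb R R i).map ·)
          (CochainComplex.of_d L.obj L.d p)).trans (L.w p))) }

end GradedLift

/-- The graded lift underlying a lift of a complex. -/
noncomputable def ComplexLift.toGradedLift (K : ComplexLift Rb R i E) : GradedLift Rb R i E where
  obj := K.complex.obj.X
  injective := K.injective
  iso := K.isoX
  d n := K.complex.obj.d n (n + 1)
  w n := ((CochainComplex.Plus.ι C).map K.iso.hom).comm n (n + 1)

lemma ComplexLift.isComplex_toGradedLift (K : ComplexLift Rb R i E) :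
    K.toGradedLift.IsComplex := fun n => K.complex.obj.d_comp_d n (n + 1) (n + 1 + 1)

lemma ComplexLift.dTo_toGradedLift (K : ComplexLift Rb R i E) (p q : ℤ) (h : p + 1 = q) :
    K.toGradedLift.dTo p q h = K.complex.obj.d p q := by
  subst h
  exact K.toGradedLift.dTo_self p

lemma GradedLift.toGradedLift_toComplexLift (S : Type*) [CommRing S] [Algebra R S]
    [SmallExtension Rb R S] (L : GradedLift Rb R i E) (hL : L.IsComplex) :
    (L.toComplexLift S hL).toGradedLift = L := by
  have hd : (L.toComplexLift S hL).toGradedLift.d = L.d :=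
    funext fun n => CochainComplex.of_d L.obj L.d n
  have hiso : (L.toComplexLift S hL).toGradedLift.iso = L.iso :=
    funext fun n => Iso.ext rfl
  -- The objects agree by definition, but the differential of `CochainComplex.of` is `L.d` only up
  -- to a proved equality.
  have key : ∀ (obj : ℤ → Cb) (inj : ∀ n, Injective (obj n))
      (iso iso' : ∀ n, E.obj.X n ≅ (homFunctor Rb R R i).obj (obj n))
      (d d' : ∀ n, obj n ⟶ obj (n + 1)) (w w'), iso = iso' → d = d' →
      GradedLift.mk obj inj iso d w = GradedLift.mk obj inj iso' d' w' := by
    rintro _ _ _ _ _ _ _ _ rfl rfl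
    rfl
  exact key _ _ _ _ _ _ _ _ hiso hd

lemma ComplexLift.isDifference_of_isDifferenceAlong (K K' : ComplexLift Rb R i E)
    {z : Cocycle (mapPlus (homFunctor R S (RelKernel Rb R S) i₀) E)
      (mapPlus (homFunctor R S S i₀) E) 1}
    (hz : K.toGradedLift.IsDifferenceAlong K'.toGradedLift (𝟙 E) z.1) :
    K.IsDifference S i₀ K' z := by
  obtain ⟨φ, hφ, hz⟩ := hz
  refine ⟨φ, fun n => (hφ n).trans (Category.id_comp _), fun n => ?_⟩
  refine (representsKernelMap_iff Rb R S (K.isoX n) (K'.isoX (n + 1))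
    (z.1.v n (n + 1) rfl) _).2 ?_
  have := hz n (n + 1) rfl
  rw [dTo_toGradedLift, dTo_toGradedLift] at this
  exact this

/-- A lift of a map of complexes to a map of graded objects that commutes with the differentials
is a map of complexes. -/
lemma ComplexLift.exists_hom (K : ComplexLift Rb R i E) (K' : ComplexLift Rb R i E') (f : E ⟶ E')
    (hf : K.toGradedLift.IsDifferenceAlong K'.toGradedLift f
      (0 : Cochain (mapPlus (homFunctor R S (RelKernel Rb R S) i₀) E)
        (mapPlus (homFunctor R S S i₀) E') 1)) :
    ∃ ψ : K.complex ⟶ K'.complex,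
      K.iso.hom ≫ (homFunctor Rb R R i).mapCochainComplexPlus.map ψ = f ≫ K'.iso.hom := by
  obtain ⟨φ, hφ, hz⟩ := hf
  refine ⟨ObjectProperty.homMk
    { f := φ
      comm' := fun p q (h : p + 1 = q) => ?_ }, ?_⟩
  · have := hz p q h
    rw [GradedLift.kerCochain_zero, dTo_toGradedLift, dTo_toGradedLift, eq_comm,
      sub_eq_zero] at this
    exact this
  · ext n
    exact hφ n

variable (S i₀) in
lemma ComplexLift.isDifferenceAlong_of_hom (K : ComplexLift Rb R i E) (K' : ComplexLift Rb R i E')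
    {f : E ⟶ E'} (ψ : K.complex ⟶ K'.complex)
    (h : K.iso.hom ≫ (homFunctor Rb R R i).mapCochainComplexPlus.map ψ = f ≫ K'.iso.hom) :
    K.toGradedLift.IsDifferenceAlong K'.toGradedLift f
      (0 : Cochain (mapPlus (homFunctor R S (RelKernel Rb R S) i₀) E)
        (mapPlus (homFunctor R S S i₀) E') 1) := by
  refine ⟨fun n => ψ.hom.f n, fun n => ?_, fun p q h => ?_⟩
  · exact congrArg (fun α : E ⟶ _ => α.hom.f n) h
  · rw [GradedLift.kerCochain_zero, dTo_toGradedLift, dTo_toGradedLift, eq_comm, sub_eq_zero]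
    exact ψ.hom.comm p q

end GradedLifts


/-! ### Cocycles and morphisms in the derived category -/

section DerivedClasses

variable {C D : Type*} [Category C] [Category D] [Abelian C] [Abelian D]
  [HasDerivedCategory C] [HasDerivedCategory D]

omit [HasDerivedCategory C] in
lemma isKInjective_of_plus (L : CochainComplex.Plus C) (hL : ∀ n, Injective (L.obj.X n)) :
    L.obj.IsKInjective := by
  obtain ⟨n, hn⟩ := L.property
  exact CochainComplex.isKInjective_of_injective L.obj n

/-- Bounded below complexes of injectives are K-injective, so morphisms into them in the derived
category are homotopy classes of maps of complexes. -/
lemma exists_plusQ_map_eq {K L : CochainComplex.Plus C} (hL : ∀ n, Injective (L.obj.X n))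
    (u : DerivedCategory.Plus.Q.obj K ⟶ DerivedCategory.Plus.Q.obj L) :
    ∃ f : K ⟶ L, DerivedCategory.Plus.Q.map f = u := by
  obtain ⟨v, hv⟩ := (DerivedCategory.Plus.Qh_map_bijective_of_isKInjective
    ((HomotopyCategory.Plus.quotient C).obj K) ((HomotopyCategory.Plus.quotient C).obj L)
    (isKInjective_of_plus L hL)).surjective u
  obtain ⟨f, rfl⟩ := (HomotopyCategory.Plus.quotient C).map_surjective v
  exact ⟨f, hv⟩

lemma nonempty_homotopy_of_plusQ_map_eq {K L : CochainComplex.Plus C}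
    (hL : ∀ n, Injective (L.obj.X n)) {f g : K ⟶ L}
    (h : DerivedCategory.Plus.Q.map f = DerivedCategory.Plus.Q.map g) :
    Nonempty (Homotopy f.hom g.hom) := by
  have h' : (HomotopyCategory.Plus.quotient C).map f = (HomotopyCategory.Plus.quotient C).map g :=
    (DerivedCategory.Plus.Qh_map_bijective_of_isKInjective
      ((HomotopyCategory.Plus.quotient C).obj K) ((HomotopyCategory.Plus.quotient C).obj L)
      (isKInjective_of_plus L hL)).injective h
  exact ⟨HomotopyCategory.homotopyOfEq _ _ ((HomotopyCategory.Plus.ι C).congr_map h')⟩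

lemma plusQ_map_eq_of_homotopy {K L : CochainComplex.Plus C} {f g : K ⟶ L}
    (h : Homotopy f.hom g.hom) : DerivedCategory.Plus.Q.map f = DerivedCategory.Plus.Q.map g := by
  have h' : (HomotopyCategory.Plus.quotient C).map f = (HomotopyCategory.Plus.quotient C).map g :=
    (HomotopyCategory.Plus.ι C).map_injective (HomotopyCategory.eq_of_homotopy _ _ h)
  exact congrArg DerivedCategory.Plus.Qh.map h'

variable [EnoughInjectives C] (G G' : C ⥤ D) [G.Additive] [G'.Additive]

lemma isIso_derivedUnit (K : CochainComplex.Plus C) (hK : ∀ n, Injective (K.obj.X n)) :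
    IsIso (derivedUnit G K) := by
  -- `K` is the image of a complex in the category of injective objects, and on such images the unit
  -- is invertible.
  let K' : CochainComplex.Plus (InjectiveObject C) :=
    ⟨HomologicalComplex.liftObjectProperty _ K.obj hK, by
      obtain ⟨n, hn⟩ := K.property
      refine ⟨n, ?_⟩
      rwa [← CochainComplex.isStrictlyGE_mapHomologicalComplex_obj_iff _ (InjectiveObject.ι _)]⟩
  exact inferInstanceAs (IsIso (G.rightDerivedFunctorPlusUnit.app
      ((HomotopyCategory.Plus.quotient C).obj
        ((InjectiveObject.ι C).mapCochainComplexPlus.obj K'))))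

lemma derivedUnit_naturality {K L : CochainComplex.Plus C} (f : K ⟶ L) :
    DerivedCategory.Plus.Q.map (G.mapCochainComplexPlus.map f) ≫ derivedUnit G L =
      derivedUnit G K ≫ G.rightDerivedFunctorPlus.map (DerivedCategory.Plus.Q.map f) :=
  G.rightDerivedFunctorPlusUnit.naturality ((HomotopyCategory.Plus.quotient C).map f)

namespace BddInjectiveResolution

variable {X : DerivedCategory.Plus C} (E E' : BddInjectiveResolution X)

instance isIso_comparison : IsIso (E.comparison G) := by
  have := isIso_derivedUnit G E.complex E.injective
  have h : IsIso (derivedUnit G E.complex ≫ G.rightDerivedFunctorPlus.map E.iso.hom).hom :=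
    inferInstanceAs (IsIso ((DerivedCategory.Plus.ι (C := D)).map
      (derivedUnit G E.complex ≫ G.rightDerivedFunctorPlus.map E.iso.hom)))
  exact @IsIso.comp_isIso _ _ _ _ _ _ _ inferInstance h

lemma exists_hom : ∃ f : E.complex ⟶ E'.complex,
    DerivedCategory.Plus.Q.map f ≫ E'.iso.hom = E.iso.hom := by
  obtain ⟨f, hf⟩ := exists_plusQ_map_eq E'.injective (E.iso.hom ≫ E'.iso.inv)
  exact ⟨f, by simp [hf]⟩

variable {E E'} in
lemma map_comparison {f : E.complex ⟶ E'.complex}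
    (hf : DerivedCategory.Plus.Q.map f ≫ E'.iso.hom = E.iso.hom) :
    DerivedCategory.Q.map (mapPlusHom G f) ≫ E'.comparison G = E.comparison G := by
  have h := congrArg (fun t => t ≫ G.rightDerivedFunctorPlus.map E'.iso.hom)
    (derivedUnit_naturality G f)
  simp only [Category.assoc] at h
  rw [← Functor.map_comp, hf] at h
  exact (Category.assoc ..).symm.trans
    ((congrArg (· ≫ (derivedUnit G E'.complex ≫ G.rightDerivedFunctorPlus.map E'.iso.hom).hom)
      ((DerivedCategory.quotientCompQhIso D).inv.naturality (mapPlusHom G f))).trans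
    ((Category.assoc ..).trans (congrArg ((DerivedCategory.quotientCompQhIso D).inv.app _ ≫ ·)
      (congrArg (DerivedCategory.Plus.ι (C := D)).map h))))

/-- The class in the derived category of a cocycle of the complex of homomorphisms between
the complexes that compute two derived functors. -/
noncomputable def cls {n : ℤ} (z : Cocycle (mapPlus G E.complex) (mapPlus G' E'.complex) n) :
    RHomCohomology (G.rightDerivedFunctorPlus.obj X) (G'.rightDerivedFunctorPlus.obj X) n :=
  inv (E.comparison G) ≫ ShiftedHom.map (Cocycle.equivHomShift.symm z) DerivedCategory.Q ≫
    (E'.comparison G')⟦n⟧'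

variable {E E' G G'}

lemma isClassOf_iff {n : ℤ} {z : Cocycle (mapPlus G E.complex) (mapPlus G' E.complex) n}
    {o : RHomCohomology (G.rightDerivedFunctorPlus.obj X) (G'.rightDerivedFunctorPlus.obj X) n} :
    E.IsClassOf z o ↔ cls G G' E E z = o := by
  unfold IsClassOf cls
  rw [IsIso.inv_comp_eq, eq_comm]

lemma cls_add {n : ℤ} (z z' : Cocycle (mapPlus G E.complex) (mapPlus G' E'.complex) n) :
    cls G G' E E' (z + z') = cls G G' E E' z + cls G G' E E' z' := by
  unfold cls
  rw [map_add, ShiftedHom.map_add]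
  exact (congrArg (inv (E.comparison G) ≫ ·) (Preadditive.add_comp ..)).trans
    (Preadditive.comp_add ..)

lemma cls_zero {n : ℤ} :
    cls G G' E E' (0 : Cocycle (mapPlus G E.complex) (mapPlus G' E'.complex) n) = 0 := by
  simpa using cls_add (E := E) (E' := E') (G := G) (G' := G') (n := n) 0 0

lemma cls_sub {n : ℤ} (z z' : Cocycle (mapPlus G E.complex) (mapPlus G' E'.complex) n) :
    cls G G' E E' (z - z') = cls G G' E E' z - cls G G' E E' z' := by
  rw [eq_sub_iff_add_eq, ← cls_add, sub_add_cancel]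

/-- A map of resolutions over `X` does not change the class; this and `cls_postcomp` compare
cocycles on different resolutions. -/
lemma cls_precomp {E₁ : BddInjectiveResolution X} {f : E.complex ⟶ E₁.complex}
    (hf : DerivedCategory.Plus.Q.map f ≫ E₁.iso.hom = E.iso.hom) {n : ℤ}
    (z : Cocycle (mapPlus G E₁.complex) (mapPlus G' E'.complex) n) :
    cls G G' E E' (z.precomp (mapPlusHom G f)) = cls G G' E₁ E' z := by
  unfold cls
  rw [IsIso.inv_comp_eq, ← map_comparison G hf, Category.assoc, IsIso.hom_inv_id_assoc,
    Cocycle.equivHomShift_symm_precomp]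
  simp only [ShiftedHom.map, Functor.map_comp, Category.assoc]

lemma cls_postcomp {E₁ : BddInjectiveResolution X} {f : E'.complex ⟶ E₁.complex}
    (hf : DerivedCategory.Plus.Q.map f ≫ E₁.iso.hom = E'.iso.hom) {n : ℤ}
    (z : Cocycle (mapPlus G E.complex) (mapPlus G' E'.complex) n) :
    cls G G' E E₁ (z.postcomp (mapPlusHom G' f)) = cls G G' E E' z := by
  unfold cls
  rw [← map_comparison G' hf, Functor.map_comp, Cocycle.equivHomShift_symm_postcomp]
  simp only [ShiftedHom.map, Functor.map_comp, Category.assoc]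
  congr 2
  exact (DerivedCategory.Q.commShiftIso n).hom.naturality_assoc (mapPlusHom G' f) _

section

variable (hE' : ∀ k, Injective (G'.obj (E'.complex.obj.X k)))
include hE'

/-- The complex `G' E'` is K-injective, so a morphism to its shift vanishes in the derived category
exactly when it is null-homotopic. -/
lemma cls_eq_zero_iff {n : ℤ} (z : Cocycle (mapPlus G E.complex) (mapPlus G' E'.complex) n) :
    cls G G' E E' z = 0 ↔ z ∈ coboundaries _ _ n := by
  have hK : (mapPlus G' E'.complex).IsKInjective :=
    isKInjective_of_plus (G'.mapCochainComplexPlus.obj E'.complex) hE'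
  have hQ : DerivedCategory.Q.map (Cocycle.equivHomShift.symm z) = 0 ↔
      (HomotopyCategory.quotient D _).map (Cocycle.equivHomShift.symm z) = 0 := by
    rw [← ((CochainComplex.IsKInjective.Qh_map_bijective _ _).injective).eq_iff, Functor.map_zero,
      ← cancel_mono ((DerivedCategory.quotientCompQhIso D).hom.app _), zero_comp,
      DerivedCategory.quotientCompQhIso_hom_naturality, ← cancel_epi
      ((DerivedCategory.quotientCompQhIso D).hom.app (mapPlus G E.complex)), comp_zero]
  rw [← CohomologyClass.toHom_mk_eq_zero_iff, CohomologyClass.toHom_mk, ← hQ]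
  unfold cls ShiftedHom.map
  rw [IsIso.inv_comp_eq]
  constructor
  · intro h
    have h' : DerivedCategory.Q.map (Cocycle.equivHomShift.symm z) ≫
        (DerivedCategory.Q.commShiftIso n).hom.app _ ≫ (E'.comparison G')⟦n⟧' = 0 := by
      rw [← Category.assoc, h]
      exact comp_zero
    simpa using (cancel_mono ((DerivedCategory.Q.commShiftIso n).hom.app _ ≫
      (E'.comparison G')⟦n⟧')).1 (h'.trans zero_comp.symm)
  · intro h
    rw [h]
    refine Eq.trans ?_ comp_zero.symm
    simp

lemma cls_surjective {n : ℤ} (o : RHomCohomology (G.rightDerivedFunctorPlus.obj X)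
    (G'.rightDerivedFunctorPlus.obj X) n) : ∃ z, cls G G' E E' z = o := by
  have hK : (mapPlus G' E'.complex).IsKInjective :=
    isKInjective_of_plus (G'.mapCochainComplexPlus.obj E'.complex) hE'
  let m : DerivedCategory.Q.obj (mapPlus G E.complex) ⟶
      DerivedCategory.Q.obj ((mapPlus G' E'.complex)⟦n⟧) :=
    E.comparison G ≫ o ≫ inv ((E'.comparison G')⟦n⟧') ≫
      (DerivedCategory.Q.commShiftIso n).inv.app _
  obtain ⟨v, hv⟩ := (CochainComplex.IsKInjective.Qh_map_bijective
    ((HomotopyCategory.quotient D _).obj (mapPlus G E.complex))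
    ((mapPlus G' E'.complex)⟦n⟧)).surjective
    ((DerivedCategory.quotientCompQhIso D).hom.app _ ≫ m ≫
      (DerivedCategory.quotientCompQhIso D).inv.app _)
  obtain ⟨g, rfl⟩ := (HomotopyCategory.quotient D _).map_surjective v
  have hg : DerivedCategory.Q.map g = m := by
    have h := DerivedCategory.quotientCompQhIso_hom_naturality g
    rw [hv, Category.assoc, Category.assoc, Iso.inv_hom_id_app, cancel_epi] at h
    exact h.symm.trans (Category.comp_id _)
  refine ⟨Cocycle.equivHomShift g, ?_⟩
  unfold cls
  rw [AddEquiv.symm_apply_apply, IsIso.inv_comp_eq]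
  unfold ShiftedHom.map
  rw [hg]
  simp [m]

end

end BddInjectiveResolution

end DerivedClasses


/-- A torsor is determined by its difference function. -/
lemma exists_addTorsor_of_difference {G P : Type*} [AddCommGroup G] [Nonempty P] (d : P → P → G)
    (hadd : ∀ p q r, d p q + d q r = d p r) (hzero : ∀ p q, d p q = 0 → p = q)
    (hsurj : ∀ p g, ∃ q, d p q = g) :
    ∃ _ : AddTorsor G P, ∀ p q : P, q -ᵥ p = d p q := by
  have hinj : ∀ p q q', d p q = d p q' → q = q' := fun p q q' h =>
    hzero _ _ (by rw [← hadd p q q'] at h; exact left_eq_add.1 h)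
  have hself : ∀ p, d p p = 0 := fun p => left_eq_add.1 (hadd p p p).symm
  choose v hv using hsurj
  exact ⟨{
    vadd := fun g p => v p g
    vsub := fun q p => d p q
    zero_vadd := fun p => hinj p _ _ ((hv p 0).trans (hself p).symm)
    add_vadd := fun g g' p => hinj p _ _ <| (hv p (g + g')).trans <| by
      change _ = d p (v (v p g') g)
      rw [← hadd p (v p g'), hv, hv, add_comm]
    vsub_vadd' := fun q p => hinj p _ _ (hv p (d p q))
    vadd_vsub' := fun g p => hv p g }, fun _ _ => rfl⟩

lemma nonempty_bddInjectiveResolution {C : Type*} [Category C] [Abelian C]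
    [HasDerivedCategory C] [EnoughInjectives C] (X : DerivedCategory.Plus C) :
    Nonempty (BddInjectiveResolution X) := by
  obtain ⟨n, hn⟩ := X.property
  have : X.IsGE n := (X.isGE_ι_obj_iff n).1 hn
  obtain ⟨L, -, ⟨e⟩⟩ := X.exists_injective_nonempty_iso n
  exact ⟨⟨_, fun k => (L.obj.X k).property, e⟩⟩

/-! ### Lifts in the derived category -/

section Deformation

variable {Rb R S : Type*} [CommRing Rb] [CommRing R] [CommRing S] [Algebra Rb R] [Algebra R S]
  [IsCoherentRing Rb] [Module.FinitePresentation Rb R] [Module.FinitePresentation R S]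
  [SmallExtension Rb R S]
  {Cb C C₀ : Type*} [Category Cb] [Category C] [Category C₀] [Abelian Cb] [Abelian C] [Abelian C₀]
  [Linear Rb Cb] [Linear R C] [Linear S C₀] [IsFlatAbelian Rb Cb]
  [EnoughInjectives Cb] [EnoughInjectives C]
  [HasDerivedCategory Cb] [HasDerivedCategory C] [HasDerivedCategory C₀]
  {i : C ⥤ Cb} [IsAbelianDeformation Rb R i] {i₀ : C₀ ⥤ C} [IsAbelianDeformation R S i₀]
  {X : DerivedCategory.Plus C}

variable (Rb S i₀) in
include Rb in
lemma BddInjectiveResolution.injective_homFunctor_obj (E : BddInjectiveResolution X) (k : ℤ) :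
    Injective ((homFunctor R S S i₀).obj (E.complex.obj.X k)) :=
  have := E.injective k
  DerivedLifting.injective_homFunctor_obj R S i₀ (SmallExtension.surjective_right Rb) _

variable (S i) in
include S in
lemma BddInjectiveResolution.nonempty_gradedLift (E : BddInjectiveResolution X) :
    Nonempty (GradedLift Rb R i E.complex) := by
  have := E.injective
  choose obj hobj iso using fun n => exists_injective_lift Rb R i
    (SmallExtension.surjective_left S) (SmallExtension.mul_eq_zero Rb R S) (E.complex.obj.X n)
  choose d hd using fun n => exists_isLiftOf S (iso n).some (iso (n + 1)).some
    (E.complex.obj.d n (n + 1))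
  exact ⟨⟨obj, hobj, fun n => (iso n).some, d, hd⟩⟩

/-- The obstruction depends neither on the resolution nor on the graded lift. -/
lemma cls_isSquare_eq {E E' : BddInjectiveResolution X} {L : GradedLift Rb R i E.complex}
    {L' : GradedLift Rb R i E'.complex}
    {z : Cocycle (mapPlus (homFunctor R S (RelKernel Rb R S) i₀) E.complex)
      (mapPlus (homFunctor R S S i₀) E.complex) 2}
    {z' : Cocycle (mapPlus (homFunctor R S (RelKernel Rb R S) i₀) E'.complex)
      (mapPlus (homFunctor R S S i₀) E'.complex) 2}
    (hz : L.IsSquare S i₀ z) (hz' : L'.IsSquare S i₀ z') :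
    BddInjectiveResolution.cls _ _ E' E' z' = BddInjectiveResolution.cls _ _ E E z := by
  obtain ⟨f, hf⟩ := E.exists_hom E'
  have h := (BddInjectiveResolution.cls_eq_zero_iff (E := E)
    (BddInjectiveResolution.injective_homFunctor_obj Rb S i₀ E') _).2 (GradedLift.isSquare_naturality f hz hz')
  rwa [BddInjectiveResolution.cls_sub, BddInjectiveResolution.cls_precomp hf,
    BddInjectiveResolution.cls_postcomp hf, sub_eq_zero] at h

section Lifts

variable {ℓ ℓ' ℓ'' : Lift (rHom Rb R R i) X}

/-- A morphism between lifts of `X` that is compatible with the isomorphisms from `X`, but not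
known to be an isomorphism. -/
def IsLiftHom (ℓ ℓ' : Lift (rHom Rb R R i) X) (u : ℓ.obj ⟶ ℓ'.obj) : Prop :=
  ℓ.iso.hom ≫ (rHom Rb R R i).map u = ℓ'.iso.hom

variable (S) in
include S in
-- The homotopy from the image of `χ` to the identity lifts to graded maps `s`. Subtracting the
-- null-homotopic map that they define leaves a map `θ` which represents the same morphism and lifts
-- the identity in each degree, so it is an isomorphism of complexes.
lemma isIso_plusQ_map (K : CochainComplex.Plus Cb) (hK : ∀ n, Injective (K.obj.X n)) (χ : K ⟶ K)
    (hχ : DerivedCategory.Plus.Q.map ((homFunctor Rb R R i).mapCochainComplexPlus.map χ) = 𝟙 _) :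
    IsIso (DerivedCategory.Plus.Q.map χ) := by
  have hs := SmallExtension.surjective_left (Rb := Rb) (R := R) S
  obtain ⟨h⟩ := nonempty_homotopy_of_plusQ_map_eq
    (fun n => injective_homFunctor_obj Rb R i hs (K.obj.X n))
    (hχ.trans (DerivedCategory.Plus.Q.map_id _).symm)
  let t (p q : ℤ) : (homFunctor Rb R R i).obj (K.obj.X p) ⟶
    (homFunctor Rb R R i).obj (K.obj.X q) := h.hom p q
  choose s hs' using fun p q => exists_homFunctor_map_eq Rb R i hs (t p q)
  let N : K.obj ⟶ K.obj := Homotopy.nullHomotopicMap' fun p q _ => s p q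
  let θ : K ⟶ K := ObjectProperty.homMk (χ.hom - N)
  have hθ : ∀ n, (homFunctor Rb R R i).map (θ.hom.f n) = 𝟙 _ := fun n => by
    have hN : (homFunctor Rb R R i).map (N.f n) =
        (homFunctor Rb R R i).map (K.obj.d n (n + 1)) ≫ t (n + 1) n +
          t n (n - 1) ≫ (homFunctor Rb R R i).map (K.obj.d (n - 1) n) := by
      rw [← hs', ← hs', ← Functor.map_comp, ← Functor.map_comp, ← Functor.map_add]
      exact congrArg _ (Homotopy.nullHomotopicMap'_f (by simp) (by simp) _)
    have hc := h.comm n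
    rw [dNext_eq h.hom (i' := n + 1) (by simp), prevD_eq h.hom (j' := n - 1) (by simp)] at hc
    exact (Functor.map_sub ..).trans (sub_eq_of_eq_add' (hc.trans (congrArg (· + _) hN.symm)))
  have hiso : IsIso θ.hom := by
    have : ∀ n, IsIso (θ.hom.f n) := fun n =>
      isIso_of_isIso_homFunctor_map Rb R i hs (SmallExtension.mul_eq_zero Rb R S) _ (hθ n)
    exact HomologicalComplex.Hom.isIso_of_components _
  have hiso' : IsIso θ := by
    have : IsIso ((CochainComplex.Plus.ι Cb).map θ) := hiso
    exact isIso_of_fully_faithful (CochainComplex.Plus.ι Cb) θ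
  have hQ : DerivedCategory.Plus.Q.map χ = DerivedCategory.Plus.Q.map θ :=
    plusQ_map_eq_of_homotopy (Homotopy.equivSubZero.symm
      ((Homotopy.ofEq (sub_sub_cancel χ.hom N)).trans (Homotopy.nullHomotopy' _)))
  rw [hQ]
  infer_instance

variable (S) in
include S in
lemma isIso_of_rHom_map_eq_id {Y : DerivedCategory.Plus Cb} (u : Y ⟶ Y)
    (hu : (rHom Rb R R i).map u = 𝟙 _) : IsIso u := by
  obtain ⟨K⟩ := nonempty_bddInjectiveResolution Y
  obtain ⟨χ, hχ⟩ := exists_plusQ_map_eq K.injective (K.iso.hom ≫ u ≫ K.iso.inv)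
  have := isIso_derivedUnit (homFunctor Rb R R i) K.complex K.injective
  have h : IsIso (DerivedCategory.Plus.Q.map χ) := by
    refine isIso_plusQ_map (Rb := Rb) (R := R) (i := i) S K.complex K.injective χ ?_
    rw [← cancel_mono (derivedUnit (homFunctor Rb R R i) K.complex), derivedUnit_naturality, hχ,
      Functor.map_comp, Functor.map_comp]
    change _ ≫ _ ≫ (rHom Rb R R i).map u ≫ _ = _
    rw [hu]
    simp [← Functor.map_comp]
  rw [hχ] at h
  have h' : IsIso (K.iso.inv ≫ (K.iso.hom ≫ u ≫ K.iso.inv) ≫ K.iso.hom) := inferInstance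
  simpa using h'

variable (S) in
include S in
-- Both composites of `u` and `v` go to the identity under the derived functor, hence are
-- invertible. No relation between `u` and `v` is needed.
lemma IsLiftHom.isIsomorphic {u : ℓ.obj ⟶ ℓ'.obj} {v : ℓ'.obj ⟶ ℓ.obj} (hu : IsLiftHom (Rb := Rb) (R := R) (i := i) ℓ ℓ' u)
    (hv : IsLiftHom ℓ' ℓ v) : IsIsomorphic ℓ ℓ' := by
  have h₁ : IsIso (u ≫ v) := isIso_of_rHom_map_eq_id (Rb := Rb) (R := R) (i := i) S _ (by
    rw [← cancel_epi ℓ.iso.hom, Functor.map_comp, ← Category.assoc, hu, hv, Category.comp_id])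
  have h₂ : IsIso (v ≫ u) := isIso_of_rHom_map_eq_id (Rb := Rb) (R := R) (i := i) S _ (by
    rw [← cancel_epi ℓ'.iso.hom, Functor.map_comp, ← Category.assoc, hv, hu, Category.comp_id])
  have : IsIso u := by
    have : IsSplitMono u := ⟨⟨v ≫ inv (u ≫ v), by rw [← Category.assoc, IsIso.hom_inv_id]⟩⟩
    have : Epi u := epi_of_epi v u
    exact isIso_of_epi_of_isSplitMono u
  exact ⟨Groupoid.isoEquivHom _ _ |>.symm ⟨asIso u, hu⟩⟩

section

variable {E E' E'' : BddInjectiveResolution X} {K : ComplexLift Rb R i E.complex}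
  {K' : ComplexLift Rb R i E'.complex} {K'' : ComplexLift Rb R i E''.complex}

/-- The morphism `u` is represented by a map `ψ` of complexes of injectives, and `g` is defined as
the image of `ψ`, so that `ψ` lifts it strictly. -/
lemma ComplexLift.Realizes.exists_hom (h : K.Realizes ℓ) (h' : K'.Realizes ℓ')
    {u : ℓ.obj ⟶ ℓ'.obj} (hu : IsLiftHom ℓ ℓ' u) :
    ∃ (ψ : K.complex ⟶ K'.complex) (g : E.complex ⟶ E'.complex),
      K.iso.hom ≫ (homFunctor Rb R R i).mapCochainComplexPlus.map ψ = g ≫ K'.iso.hom ∧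
      DerivedCategory.Plus.Q.map g ≫ E'.iso.hom = E.iso.hom := by
  obtain ⟨e, he⟩ := h
  obtain ⟨e', he'⟩ := h'
  obtain ⟨ψ, hψ⟩ := exists_plusQ_map_eq K'.injective (e.hom ≫ u ≫ e'.inv)
  refine ⟨ψ, K.iso.hom ≫ (homFunctor Rb R R i).mapCochainComplexPlus.map ψ ≫ K'.iso.inv,
    by simp, ?_⟩
  have hn := derivedUnit_naturality (homFunctor Rb R R i) ψ
  rw [← cancel_mono ℓ'.iso.hom, Category.assoc, he', ← hu, reassoc_of% he]
  simp only [Functor.map_comp, Category.assoc]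
  rw [← Functor.map_comp_assoc _ K'.iso.inv, Iso.inv_hom_id, CategoryTheory.Functor.map_id,
    Category.id_comp, reassoc_of% hn, hψ, ← Functor.map_comp, ← Functor.map_comp]
  simp

lemma ComplexLift.Realizes.exists_isLiftHom (h : K.Realizes ℓ) (h' : K'.Realizes ℓ')
    {ψ : K.complex ⟶ K'.complex} {f : E.complex ⟶ E'.complex}
    (hψ : K.iso.hom ≫ (homFunctor Rb R R i).mapCochainComplexPlus.map ψ = f ≫ K'.iso.hom)
    (hf : DerivedCategory.Plus.Q.map f ≫ E'.iso.hom = E.iso.hom) :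
    ∃ u, IsLiftHom ℓ ℓ' u := by
  obtain ⟨e, he⟩ := h
  obtain ⟨e', he'⟩ := h'
  refine ⟨e.inv ≫ DerivedCategory.Plus.Q.map ψ ≫ e'.hom, ?_⟩
  have hn := derivedUnit_naturality (homFunctor Rb R R i) ψ
  have hψ' := congrArg DerivedCategory.Plus.Q.map hψ
  rw [IsLiftHom, ← cancel_epi E.iso.hom, reassoc_of% he]
  rw [← Functor.map_comp, Iso.hom_inv_id_assoc, Functor.map_comp, ← reassoc_of% hn,
    ← Functor.map_comp_assoc, hψ, Functor.map_comp, Category.assoc, ← he', reassoc_of% hf]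

lemma ComplexLift.exists_realizes (K : ComplexLift Rb R i E.complex) :
    ∃ ℓ : Lift (rHom Rb R R i) X, K.Realizes ℓ := by
  have := isIso_derivedUnit (homFunctor Rb R R i) K.complex K.injective
  refine ⟨⟨DerivedCategory.Plus.Q.obj K.complex, E.iso.symm ≪≫
    DerivedCategory.Plus.Q.mapIso K.iso ≪≫ asIso (derivedUnit (homFunctor Rb R R i) K.complex)⟩,
    Iso.refl _, ?_⟩
  simp

variable (S ℓ) in
include S in
-- The functor `Hom_Rb(R, -)` sends an injective resolution of `ℓ.obj` to a complex of injectives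
-- that computes its derived functor, hence to a resolution of `X`. This resolution depends on `ℓ`.
lemma exists_realizes : ∃ (E : BddInjectiveResolution X) (K : ComplexLift Rb R i E.complex),
    K.Realizes ℓ := by
  obtain ⟨K⟩ := nonempty_bddInjectiveResolution ℓ.obj
  have := isIso_derivedUnit (homFunctor Rb R R i) K.complex K.injective
  have := K.injective
  refine ⟨⟨(homFunctor Rb R R i).mapCochainComplexPlus.obj K.complex,
    fun n => injective_homFunctor_obj Rb R i (SmallExtension.surjective_left S) (K.complex.obj.X n),
    asIso (derivedUnit (homFunctor Rb R R i) K.complex) ≪≫ (rHom Rb R R i).mapIso K.iso ≪≫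
      ℓ.iso.symm⟩, ⟨K.complex, K.injective, Iso.refl _⟩, K.iso, ?_⟩
  simp

end

variable (S i₀) in
/-- `h` is the class of the difference of the differentials of lifts of complexes of injectives
that realize `ℓ` and `ℓ'`. -/
def IsDifferenceClass (ℓ ℓ' : Lift (rHom Rb R R i) X)
    (h : RHomCohomology ((rHom R S (RelKernel Rb R S) i₀).obj X) ((rHom R S S i₀).obj X) 1) :
    Prop :=
  ∃ (E E' : BddInjectiveResolution X) (K : ComplexLift Rb R i E.complex)
    (K' : ComplexLift Rb R i E'.complex) (f : E.complex ⟶ E'.complex)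
    (z : Cocycle (mapPlus (homFunctor R S (RelKernel Rb R S) i₀) E.complex)
      (mapPlus (homFunctor R S S i₀) E'.complex) 1),
    K.Realizes ℓ ∧ K'.Realizes ℓ' ∧ DerivedCategory.Plus.Q.map f ≫ E'.iso.hom = E.iso.hom ∧
      K.toGradedLift.IsDifferenceAlong K'.toGradedLift f z.1 ∧
      BddInjectiveResolution.cls _ _ E E' z = h

namespace IsDifferenceClass

variable {h h' : RHomCohomology ((rHom R S (RelKernel Rb R S) i₀).obj X)
  ((rHom R S S i₀).obj X) 1}

variable (S i₀) in
lemma exists_class (ℓ ℓ' : Lift (rHom Rb R R i) X) : ∃ h, IsDifferenceClass S i₀ ℓ ℓ' h := by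
  obtain ⟨E, K, hK⟩ := exists_realizes S ℓ
  obtain ⟨E', K', hK'⟩ := exists_realizes S ℓ'
  obtain ⟨f, hf⟩ := E.exists_hom E'
  obtain ⟨z, hz⟩ := GradedLift.exists_isDifferenceAlong S i₀ K.isComplex_toGradedLift
    K'.isComplex_toGradedLift f
  exact ⟨_, E, E', K, K', f, z, hK, hK', hf, hz, rfl⟩

/-- The square of maps between the four resolutions commutes over `X`, hence up to homotopy, which
is what `sub_mem_coboundaries` requires. Equal lifts give uniqueness of the class; isomorphic ones
give its descent to `Sk`. -/
lemma eq_of_isLiftHom {ℓ₁ ℓ₁' ℓ₂ ℓ₂' : Lift (rHom Rb R R i) X}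
    (h₁ : IsDifferenceClass S i₀ ℓ₁ ℓ₁' h) (h₂ : IsDifferenceClass S i₀ ℓ₂ ℓ₂' h')
    {u : ℓ₁.obj ⟶ ℓ₂.obj} (hu : IsLiftHom ℓ₁ ℓ₂ u) {u' : ℓ₁'.obj ⟶ ℓ₂'.obj}
    (hu' : IsLiftHom ℓ₁' ℓ₂' u') : h = h' := by
  obtain ⟨E₁, E₁', K₁, K₁', f₁, z₁, hK₁, hK₁', hf₁, hz₁, rfl⟩ := h₁
  obtain ⟨E₂, E₂', K₂, K₂', f₂, z₂, hK₂, hK₂', hf₂, hz₂, rfl⟩ := h₂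
  obtain ⟨ψ, g, hψ, hg⟩ := hK₁.exists_hom hK₂ hu
  obtain ⟨ψ', g', hψ', hg'⟩ := hK₁'.exists_hom hK₂' hu'
  obtain ⟨H⟩ := nonempty_homotopy_of_plusQ_map_eq E₂'.injective (f := f₁ ≫ g') (g := g ≫ f₂) (by
    rw [← cancel_mono E₂'.iso.hom, Functor.map_comp, Functor.map_comp, Category.assoc,
      Category.assoc, hg', hf₁, hf₂, hg])
  have hc := (BddInjectiveResolution.cls_eq_zero_iff (E := E₁)
    (BddInjectiveResolution.injective_homFunctor_obj Rb S i₀ E₂') _).2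
    (GradedLift.IsDifferenceAlong.sub_mem_coboundaries K₁.isComplex_toGradedLift
      K₂'.isComplex_toGradedLift hz₁ hz₂ (K₁.isDifferenceAlong_of_hom S i₀ K₂ ψ hψ)
      (K₁'.isDifferenceAlong_of_hom S i₀ K₂' ψ' hψ') H)
  rwa [BddInjectiveResolution.cls_sub, BddInjectiveResolution.cls_precomp hg,
    BddInjectiveResolution.cls_postcomp hg', sub_eq_zero] at hc

lemma unique (h₁ : IsDifferenceClass S i₀ ℓ ℓ' h) (h₂ : IsDifferenceClass S i₀ ℓ ℓ' h') :
    h = h' :=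
  h₁.eq_of_isLiftHom h₂ (u := 𝟙 _) (u' := 𝟙 _) (by simp [IsLiftHom]) (by simp [IsLiftHom])

lemma comp (h₁ : IsDifferenceClass S i₀ ℓ ℓ' h) (h₂ : IsDifferenceClass S i₀ ℓ' ℓ'' h') :
    IsDifferenceClass S i₀ ℓ ℓ'' (h + h') := by
  obtain ⟨E, E', K, K', f, z, hK, hK', hf, hz, rfl⟩ := h₁
  -- The realization of `ℓ'` inside `h₂` may differ from `K'`, so `h'` is recomputed from `K'` by
  -- uniqueness.
  obtain ⟨E'', K'', hK''⟩ := exists_realizes S ℓ''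
  obtain ⟨f', hf'⟩ := E'.exists_hom E''
  obtain ⟨z', hz'⟩ := GradedLift.exists_isDifferenceAlong S i₀ K'.isComplex_toGradedLift
    K''.isComplex_toGradedLift f'
  obtain rfl := unique ⟨E', E'', K', K'', f', z', hK', hK'', hf', hz', rfl⟩ h₂
  refine ⟨E, E'', K, K'', f ≫ f', z.postcomp (mapPlusHom _ f') + z'.precomp (mapPlusHom _ f),
    hK, hK'', ?_, hz.comp hz', ?_⟩
  · rw [Functor.map_comp, Category.assoc, hf', hf]
  · rw [BddInjectiveResolution.cls_add, BddInjectiveResolution.cls_precomp hf,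
      BddInjectiveResolution.cls_postcomp hf']

lemma exists_isLiftHom (h₀ : IsDifferenceClass S i₀ ℓ ℓ' 0) : ∃ u, IsLiftHom ℓ ℓ' u := by
  obtain ⟨E, E', K, K', f, z, hK, hK', hf, hz, h⟩ := h₀
  rw [BddInjectiveResolution.cls_eq_zero_iff
    (BddInjectiveResolution.injective_homFunctor_obj Rb S i₀ E')] at h
  obtain ⟨β, hβ⟩ := (mem_coboundaries_iff z 0 (zero_add 1)).1 h
  rw [← hβ] at hz
  obtain ⟨ψ, hψ⟩ := K.exists_hom K' f (hz.exists_chain_map β)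
  exact hK.exists_isLiftHom hK' hψ hf

/-- By additivity the difference in the opposite direction vanishes too, so there are morphisms of
lifts both ways. -/
lemma isIsomorphic (h₀ : IsDifferenceClass S i₀ ℓ ℓ' 0) : IsIsomorphic ℓ ℓ' := by
  obtain ⟨h', hh'⟩ := exists_class S i₀ ℓ' ℓ
  obtain ⟨h, hh⟩ := exists_class S i₀ ℓ ℓ
  obtain rfl : h = 0 := left_eq_add.1 (hh.unique (hh.comp hh))
  obtain rfl : h' = 0 := by simpa using (h₀.comp hh').unique hh
  obtain ⟨u, hu⟩ := h₀.exists_isLiftHom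
  obtain ⟨v, hv⟩ := hh'.exists_isLiftHom
  exact hu.isIsomorphic S hv

/-- Adding a cocycle of class `h` to the differential of a realization of `ℓ` gives the required
lift. -/
lemma exists_right (ℓ : Lift (rHom Rb R R i) X)
    (h : RHomCohomology ((rHom R S (RelKernel Rb R S) i₀).obj X) ((rHom R S S i₀).obj X) 1) :
    ∃ ℓ', IsDifferenceClass S i₀ ℓ ℓ' h := by
  obtain ⟨E, K, hK⟩ := exists_realizes S ℓ
  obtain ⟨z, hz⟩ := BddInjectiveResolution.cls_surjective (E := E)
    (BddInjectiveResolution.injective_homFunctor_obj Rb S i₀ E) h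
  let K' := (K.toGradedLift.perturb z.1).toComplexLift S
    (GradedLift.isComplex_perturb_of_cocycle K.isComplex_toGradedLift z)
  obtain ⟨ℓ', hK'⟩ := K'.exists_realizes
  refine ⟨ℓ', E, E, K, K', 𝟙 _, z, hK, hK', by simp, ?_, hz⟩
  rw [GradedLift.toGradedLift_toComplexLift]
  exact GradedLift.isDifferenceAlong_perturb _ _

end IsDifferenceClass

variable (i X S i₀) in
lemma exists_addTorsor [Nonempty (Lift (rHom Rb R R i) X)] :
    ∃ _ : AddTorsor
        (RHomCohomology ((rHom R S (RelKernel Rb R S) i₀).obj X) ((rHom R S S i₀).obj X) 1)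
        (Sk (Lift (rHom Rb R R i) X)),
      ∀ (ℓ ℓ' : Lift (rHom Rb R R i) X), IsDifferenceClass S i₀ ℓ ℓ'
        ((Quotient.mk _ ℓ' : Sk _) -ᵥ (Quotient.mk _ ℓ : Sk _)) := by
  choose d hd using fun ℓ ℓ' : Lift (rHom Rb R R i) X => IsDifferenceClass.exists_class S i₀ ℓ ℓ'
  have hiso : ∀ {ℓ ℓ' : Lift (rHom Rb R R i) X}, IsIsomorphic ℓ ℓ' → ∃ u, IsLiftHom ℓ ℓ' u :=
    fun ⟨e⟩ => ⟨_, e.hom.w⟩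
  let D : Sk (Lift (rHom Rb R R i) X) → Sk (Lift (rHom Rb R R i) X) → _ :=
    Quotient.lift₂ d fun ℓ₁ ℓ₁' ℓ₂ ℓ₂' e e' =>
      (hd ℓ₁ ℓ₁').eq_of_isLiftHom (hd ℓ₂ ℓ₂') (hiso e).choose_spec (hiso e').choose_spec
  have : Nonempty (Sk (Lift (rHom Rb R R i) X)) :=
    ‹Nonempty (Lift (rHom Rb R R i) X)›.map (Quotient.mk _)
  obtain ⟨t, ht⟩ := exists_addTorsor_of_difference D
    (by
      rintro ⟨p⟩ ⟨q⟩ ⟨r⟩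
      exact ((hd p q).comp (hd q r)).unique (hd p r))
    (by
      rintro ⟨p⟩ ⟨q⟩ h
      change d p q = 0 at h
      exact Quotient.sound (IsDifferenceClass.isIsomorphic (h ▸ hd p q)))
    (by
      rintro ⟨p⟩ h
      obtain ⟨q, hq⟩ := IsDifferenceClass.exists_right p h
      exact ⟨Quotient.mk _ q, (hd p q).unique hq⟩)
  refine ⟨t, fun ℓ ℓ' => ?_⟩
  rw [ht]
  exact hd ℓ ℓ'

end Lifts

end Deformation

end DerivedLifting

theorem mainTheorem4 {Rb R S : Type*} [CommRing Rb] [CommRing R] [CommRing S]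
    [Algebra Rb R] [Algebra R S] [IsCoherentRing Rb] [IsCoherentRing R] [IsCoherentRing S]
    [Module.FinitePresentation Rb R] [Module.FinitePresentation R S] [SmallExtension Rb R S]
    {Cb C C₀ : Type*} [Category* Cb] [Category* C] [Category* C₀]
    [Abelian Cb] [Abelian C] [Abelian C₀] [Linear Rb Cb] [Linear R C] [Linear S C₀]
    [IsFlatAbelian Rb Cb] [IsFlatAbelian R C] [IsFlatAbelian S C₀]
    [EnoughInjectives Cb] [EnoughInjectives C] [EnoughInjectives C₀]
    [HasDerivedCategory Cb] [HasDerivedCategory C] [HasDerivedCategory C₀]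
    (i : C ⥤ Cb) [IsAbelianDeformation Rb R i] (i₀ : C₀ ⥤ C) [IsAbelianDeformation R S i₀]
    (X : DerivedCategory.Plus C) :
    ∃ o : RHomCohomology
        ((rHom R S (RelKernel Rb R S) i₀).obj X)
        ((rHom R S S i₀).obj X) 2,
      (∀ (E : BddInjectiveResolution X) (L : GradedLift Rb R i E.complex),
        ∃ z, L.IsSquare S i₀ z ∧ E.IsClassOf z o) ∧
      (o = 0 ↔ Nonempty (Lift (rHom Rb R R i) X)) ∧
      (o = 0 → ∃ _ : AddTorsor
          (RHomCohomology
            ((rHom R S (RelKernel Rb R S) i₀).obj X)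
            ((rHom R S S i₀).obj X) 1)
          (Sk (Lift (rHom Rb R R i) X)),
        ∀ (E : BddInjectiveResolution X) (K K' : ComplexLift Rb R i E.complex)
          (ℓ ℓ' : Lift (rHom Rb R R i) X),
          K.Realizes ℓ → K'.Realizes ℓ' → ∃ z, K.IsDifference S i₀ K' z ∧
            E.IsClassOf z ((Quotient.mk _ ℓ' : Sk _) -ᵥ (Quotient.mk _ ℓ : Sk _))) := by
  obtain ⟨E₀⟩ := nonempty_bddInjectiveResolution X
  obtain ⟨L₀⟩ := BddInjectiveResolution.nonempty_gradedLift (Rb := Rb) (R := R) S i E₀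
  obtain ⟨z₀, hz₀⟩ := GradedLift.exists_isSquare S i₀ L₀
  have ho : BddInjectiveResolution.cls _ _ E₀ E₀ z₀ = 0 ↔ Nonempty (Lift (rHom Rb R R i) X) := by
    constructor
    · intro h
      rw [BddInjectiveResolution.cls_eq_zero_iff
        (BddInjectiveResolution.injective_homFunctor_obj Rb S i₀ E₀)] at h
      obtain ⟨β, hβ⟩ := (mem_coboundaries_iff z₀ 1 one_add_one_eq_two).1 h
      exact ⟨((L₀.perturb (-β)).toComplexLift S
        (GradedLift.isComplex_perturb_of_isSquare hz₀ hβ)).exists_realizes.choose⟩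
    · rintro ⟨ℓ⟩
      obtain ⟨E, K, -⟩ := exists_realizes S ℓ
      -- An actual complex has the zero cocycle as its square, and the class may be computed from
      -- this resolution instead of `E₀`.
      have hK : K.toGradedLift.IsSquare S i₀ 0 := by
        rw [GradedLift.isSquare_iff]
        intro p q r hpq hqr
        rw [K.isComplex_toGradedLift.dTo_comp_dTo]
        exact GradedLift.kerCochain_zero ..
      rw [← cls_isSquare_eq hz₀ hK]
      exact BddInjectiveResolution.cls_zero
  refine ⟨BddInjectiveResolution.cls _ _ E₀ E₀ z₀, fun E L => ?_, ho, fun h => ?_⟩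
  · obtain ⟨z, hz⟩ := GradedLift.exists_isSquare S i₀ L
    exact ⟨z, hz, BddInjectiveResolution.isClassOf_iff.2 (cls_isSquare_eq hz₀ hz)⟩
  · have := ho.1 h
    obtain ⟨t, ht⟩ := exists_addTorsor (Rb := Rb) (R := R) S i i₀ X
    refine ⟨t, fun E K K' ℓ ℓ' hK hK' => ?_⟩
    obtain ⟨z, hz⟩ := GradedLift.exists_isDifferenceAlong S i₀ K.isComplex_toGradedLift
      K'.isComplex_toGradedLift (𝟙 _)
    have hd : IsDifferenceClass S i₀ ℓ ℓ' (BddInjectiveResolution.cls _ _ E E z) :=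
      ⟨E, E, K, K', 𝟙 _, z, hK, hK', by simp, hz, rfl⟩
    exact ⟨z, K.isDifference_of_isDifferenceAlong K' hz,
      BddInjectiveResolution.isClassOf_iff.2 (hd.unique (ht ℓ ℓ'))⟩
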